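/- **Theorem (Projection effect of $\mathrm{MPCA}_F$).** Fix integers $p_0,q_0\ge 1$, put $r_0=\min(p_0,q_0)$, and let $T,p,q\to\infty$ jointly (along an arbitrary sequence). The $p\times q$ observations follow the matrix elliptical factor model $$X_t=RF_tC^\top+E_t,\quad F_t=\frac{r_t}{\|Z_t\|_2}\Sigma_1^{1/2}Z_t^F\Sigma_2^{1/2},\quad E_t=\frac{r_t}{\|Z_t\|_2}\Omega_1^{1/2}Z_t^E\Omega_2^{1/2},\qquad t=1,\dots,T,$$ with $R\in\mathbb R^{p\times p_0}$, $C\in\mathbb R^{q\times q_0}$ deterministic, under the following assumptions. * (A) $Z_t=(Z_t^F,Z_t^E)\in\mathbb R^{p_0\times q_0}\times\mathbb R^{p\times q}$ is a standard Gaussian vector of dimension $p_0q_0+pq$, $r_t>0$ is a random variable independent of $Z_t$, the pairs $(r_t,Z_t)$ are independent over $t$, and $(pq)^{-1/2}r_t=O_p(1)$ for each $t$. * (B) $R^\top R/p=I_{p_0}$, $C^\top C/q=I_{q_0}$, and all eigenvalues of the symmetric matrices $\Sigma_1\in\mathbb R^{p_0\times p_0}$, $\Sigma_2\in\mathbb R^{q_0\times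 q_0}$ lie in $[c_1,C_1]$ for constants $0<c_1\le C_1$ not depending on $T,p,q$. * (C) All eigenvalues of the symmetric matrices $\Omega_1\in\mathbb R^{p\times p}$, $\Omega_2\in\mathbb R^{q\times q}$ lie in $[c_2,C_2]$ for constants $0<c_2\le C_2$ not depending on $T,p,q$. One step of $\mathrm{MPCA}_F$: given $\hat C^{(i-1)}\in\mathbb R^{q\times q_0}$ with $\hat C^{(i-1)\top}\hat C^{(i-1)}/q=I_{q_0}$, let $\hat R_t\in\mathbb R^{p\times r_0}$ consist of orthonormal eigenvectors for the $r_0$ largest eigenvalues of $X_tP_{\hat C^{(i-1)}}X_t^\top$, where $P_{\hat C^{(i-1)}}=\hat C^{(i-1)}\hat C^{(i-1)\top}/q$; then $\hat R^{(i)}/\sqrt p\in\mathbb R^{p\times p_0}$ consists of orthonormal eigenvectors for the $p_0$ largest eigenvalues of $T^{-1}\sum_{t}\hat R_t\hat R_t^\top$ (signs and ties are resolved arbitrarily). The update $\hat C^{(i)}\in\mathbb R^{q\times q_0}$ given $\hat R^{(i-1)}\in\mathbb R^{p\times p_0}$, $\hat R^{(i-1)\top}\hat R^{(i-1)}/p=I_{p_0}$,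 is defined in the same way from the matrices $X_t^\top P_{\hat R^{(i-1)}}X_t$, with $P_{\hat R^{(i-1)}}=\hat R^{(i-1)}\hat R^{(i-1)\top}/p$ and with $q$, $q_0$ in place of $p$, $p_0$. The previous estimate is treated as given, that is, as nonrandom or, more generally, as random but independent of $(r_t,Z_t)_{t\le T}$. Write $\sigma_k$ for the $k$-th largest singular value. 1. If, for some constant $c>0$, $\sigma_{q_0}(C^\top\hat C^{(i-1)})/q\ge c$ with probability tending to $1$, then there are orthogonal $p_0\times p_0$ matrices $H_R$ (depending on the sample) such that $$\|\hat R^{(i)}-RH_R\|_F^2/p=O_p\big(T^{-1}+q^{-1/2}\big).$$ 2. If, for some constant $c>0$, $\sigma_{p_0}(R^\top\hat R^{(i-1)})/p\ge c$ with probability tending to $1$, then there are orthogonal $q_0\times q_0$ matrices $H_C$ (depending on the sample) such that $$\|\hat C^{(i)}-CH_C\|_F^2/q=O_p\big(T^{-1}+p^{-1/2}\big).$$ -/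

import Mathlib

open MeasureTheory ProbabilityTheory Filter Topology
open scoped MatrixOrder

noncomputable section

/-- Stochastic boundedness `Y n = O_p (a n)` as `n → ∞`, where the `n`-th variable lives on its own
probability space. (`μ n` of an arbitrary set is the outer measure.) -/
def IsBigOp {Ω : ℕ → Type*} [∀ n, MeasurableSpace (Ω n)] (μ : ∀ n, Measure (Ω n))
    (Y : ∀ n, Ω n → ℝ) (a : ℕ → ℝ) : Prop :=
  ∀ ε : ℝ, 0 < ε → ∃ M : ℝ, ∀ᶠ n in atTop, μ n {ω | M * a n < |Y n ω|} ≤ ENNReal.ofReal ε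

/-- Squared Frobenius norm. -/
def frobSq {m k : ℕ} (A : Matrix (Fin m) (Fin k) ℝ) : ℝ := ∑ i, ∑ j, A i j ^ 2

/-- The `i`-th largest singular value, `i = 1, 2, …` (Mathlib indexes them from `0`). -/
def singVal {m k : ℕ} (i : ℕ) (A : Matrix (Fin m) (Fin k) ℝ) : ℝ :=
  (Matrix.toEuclideanLin A).singularValues (i - 1)

/-- `A` is symmetric with all its eigenvalues in `[c, C]`. -/
def SpectrumIn {m : ℕ} (A : Matrix (Fin m) (Fin m) ℝ) (c C : ℝ) : Prop :=
  ∃ h : A.IsHermitian, ∀ i, c ≤ h.eigenvalues i ∧ h.eigenvalues i ≤ C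

/-- The columns of `U` are the leading `k` eigenvectors of the symmetric matrix `A`: the first `k`
columns of the orthogonal matrix in an eigendecomposition of `A` with eigenvalues in nonincreasing
order. (Signs, and bases of eigenspaces in case of ties, are arbitrary.) -/
def IsLeadingEigenvectors {m k : ℕ} (A : Matrix (Fin m) (Fin m) ℝ)
    (U : Matrix (Fin m) (Fin k) ℝ) : Prop :=
  ∃ (hk : k ≤ m) (V : Matrix (Fin m) (Fin m) ℝ) (d : Fin m → ℝ),
    V ∈ Matrix.orthogonalGroup (Fin m) ℝ ∧ Antitone d ∧
    A = V * Matrix.diagonal d * V.transpose ∧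
    ∀ i j, U i j = V i (Fin.castLE hk j)

/-- The projection `L Lᵀ / m` onto the column space of an `m × k` loading matrix with
`Lᵀ L / m = I`. -/
def loadingProj {m k : ℕ} (L : Matrix (Fin m) (Fin k) ℝ) : Matrix (Fin m) (Fin m) ℝ :=
  (1 / (m : ℝ)) • (L * L.transpose)

/-- One half-step of the iteration `MPCA_F`, from data `X t` (`m × l`, `t < T`), the current
estimate `Bhat` of the loadings on the right and the compression rank `r`: `U t` collects the
leading `r` eigenvectors of `X t * P_Bhat * (X t)ᵀ`, and `Ahat / √m` the leading `a` eigenvectors of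
`∑ t, U t * (U t)ᵀ / T`. -/
def IsMPCAFUpdate {T m l a b : ℕ} (r : ℕ) (X : Fin T → Matrix (Fin m) (Fin l) ℝ)
    (Bhat : Matrix (Fin l) (Fin b) ℝ) (Ahat : Matrix (Fin m) (Fin a) ℝ) : Prop :=
  ∃ U : Fin T → Matrix (Fin m) (Fin r) ℝ,
    (∀ t, IsLeadingEigenvectors (X t * loadingProj Bhat * (X t).transpose) (U t)) ∧
    IsLeadingEigenvectors ((1 / (T : ℝ)) • ∑ t, U t * (U t).transpose)
      ((1 / Real.sqrt (m : ℝ)) • Ahat)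

/-- The space of the Gaussian vector `Z_t`, of dimension `p₀ q₀ + p q`. -/
abbrev LatentSpace (p₀ q₀ p q : ℕ) : Type :=
  EuclideanSpace ℝ ((Fin p₀ × Fin q₀) ⊕ (Fin p × Fin q))

/-- The `p₀ × q₀` matrix of the leading `p₀ q₀` entries. -/
def latentFactor {p₀ q₀ p q : ℕ} (z : LatentSpace p₀ q₀ p q) : Matrix (Fin p₀) (Fin q₀) ℝ :=
  Matrix.of fun i j => z (Sum.inl (i, j))

/-- The `p × q` matrix of the remaining entries. -/
def latentNoise {p₀ q₀ p q : ℕ} (z : LatentSpace p₀ q₀ p q) : Matrix (Fin p) (Fin q) ℝ :=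
  Matrix.of fun i j => z (Sum.inr (i, j))

/-- The observation `R F Cᵀ + E`, where `F = (ρ / ‖z‖) Σ₁^{1/2} Z^F Σ₂^{1/2}` and
`E = (ρ / ‖z‖) Ω₁^{1/2} Z^E Ω₂^{1/2}`, for radius `ρ` and Gaussian vector `z = (Z^F, Z^E)`. -/
def observation {p₀ q₀ p q : ℕ} (R : Matrix (Fin p) (Fin p₀) ℝ) (C : Matrix (Fin q) (Fin q₀) ℝ)
    (Sig₁ : Matrix (Fin p₀) (Fin p₀) ℝ) (Sig₂ : Matrix (Fin q₀) (Fin q₀) ℝ)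
    (Om₁ : Matrix (Fin p) (Fin p) ℝ) (Om₂ : Matrix (Fin q) (Fin q) ℝ)
    (ρ : ℝ) (z : LatentSpace p₀ q₀ p q) : Matrix (Fin p) (Fin q) ℝ :=
  R * ((ρ / ‖z‖) • (CFC.sqrt Sig₁ * latentFactor z * CFC.sqrt Sig₂)) * C.transpose +
    (ρ / ‖z‖) • (CFC.sqrt Om₁ * latentNoise z * CFC.sqrt Om₂)

/-- Joint matrix elliptical model: radii `ρ n t > 0` and standard Gaussian vectors `Z n t`,
`t < T n`, independent of each other and over `t`, with `(p q)^{-1/2} ρ_t = O_p(1)` for each `t`. -/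
structure JointElliptical {Ω : ℕ → Type*} [∀ n, MeasurableSpace (Ω n)]
    (μ : ∀ n, Measure (Ω n)) (p₀ q₀ : ℕ) (T p q : ℕ → ℕ)
    (ρ : ∀ n, Fin (T n) → Ω n → ℝ)
    (Z : ∀ n, Fin (T n) → Ω n → LatentSpace p₀ q₀ (p n) (q n)) : Prop where
  measurable_radius : ∀ n t, Measurable (ρ n t)
  measurable_latent : ∀ n t, Measurable (Z n t)
  radius_pos : ∀ n t, ∀ᵐ ω ∂(μ n), 0 < ρ n t ω
  latent_law : ∀ n t, (μ n).map (Z n t) = stdGaussian (LatentSpace p₀ q₀ (p n) (q n))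
  indep_radius_latent : ∀ n t, IndepFun (ρ n t) (Z n t) (μ n)
  indep_time : ∀ n, iIndepFun (fun t ω => (ρ n t ω, Z n t ω)) (μ n)
  radius_bounded : ∀ t : ℕ, IsBigOp μ
    (fun n ω => if h : t < T n then
      ((p n : ℝ) * (q n : ℝ)) ^ (-1 / 2 : ℝ) * ρ n ⟨t, h⟩ ω else 0)
    (fun _ => 1)

/-- Strong factor conditions. -/
structure StrongFactors {p₀ q₀ : ℕ} {p q : ℕ → ℕ}
    (R : ∀ n, Matrix (Fin (p n)) (Fin p₀) ℝ) (C : ∀ n, Matrix (Fin (q n)) (Fin q₀) ℝ)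
    (Sig₁ : ℕ → Matrix (Fin p₀) (Fin p₀) ℝ) (Sig₂ : ℕ → Matrix (Fin q₀) (Fin q₀) ℝ) : Prop where
  row_normalized : ∀ n, (1 / (p n : ℝ)) • ((R n).transpose * R n) = 1
  col_normalized : ∀ n, (1 / (q n : ℝ)) • ((C n).transpose * C n) = 1
  factor_cov : ∃ c₁ C₁ : ℝ, 0 < c₁ ∧ 0 < C₁ ∧
    ∀ n, SpectrumIn (Sig₁ n) c₁ C₁ ∧ SpectrumIn (Sig₂ n) c₁ C₁

/-- Regular noise conditions. -/
def RegularNoise {p q : ℕ → ℕ} (Om₁ : ∀ n, Matrix (Fin (p n)) (Fin (p n)) ℝ)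
    (Om₂ : ∀ n, Matrix (Fin (q n)) (Fin (q n)) ℝ) : Prop :=
  ∃ c₂ C₂ : ℝ, 0 < c₂ ∧ 0 < C₂ ∧ ∀ n, SpectrumIn (Om₁ n) c₂ C₂ ∧ SpectrumIn (Om₂ n) c₂ C₂

/-- `Lhat n` is a given (fixed beforehand) estimate of the `m n × k` loading matrix `L n`: it is
normalized, nonrandom or, more generally, random but independent of the variables `S n` that
generate the sample, and `σ_k(Lᵀ Lhat) / m` is bounded away from `0` with probability tending
to `1`. -/
structure IsGivenEstimate {Ω : ℕ → Type*} [∀ n, MeasurableSpace (Ω n)]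
    (μ : ∀ n, Measure (Ω n)) {𝓢 : ℕ → Type*} [∀ n, MeasurableSpace (𝓢 n)] (S : ∀ n, Ω n → 𝓢 n)
    {k : ℕ} {m : ℕ → ℕ} (L : ∀ n, Matrix (Fin (m n)) (Fin k) ℝ)
    (Lhat : ∀ n, Ω n → Matrix (Fin (m n)) (Fin k) ℝ) : Prop where
  measurable : ∀ n, Measurable (fun ω i j => Lhat n ω i j)
  normalized : ∀ n ω, (1 / (m n : ℝ)) • ((Lhat n ω).transpose * Lhat n ω) = 1
  indep : ∀ n, IndepFun (fun ω i j => Lhat n ω i j) (S n) (μ n)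
  nondegenerate : ∃ c : ℝ, 0 < c ∧
    Tendsto (fun n => μ n {ω | c ≤ singVal k ((L n).transpose * Lhat n ω) / (m n : ℝ)})
      atTop (𝓝 1)

end

/-! ### Frobenius norms and quadratic forms; operator bounds are written as inequalities between dot
products. -/

section FrobeniusNorm

variable {m k l : ℕ}

/-! Put V = R/√p. Up to a positive scalar carrying the radius and ‖Z_t‖, the projected Gram matrix
of X_t is AAᵀ with A = VG + N, where G = Σ₁^{1/2} Z^F Σ₂^{1/2} CᵀĈ/q and N is the projected noise
divided by q√p. Leading eigenvectors ignore the scalar, so only Gaussian matrices remain.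

For a single t let L = VK span the signal space, K being a frame of the column space of Σ₁^{1/2}
Z^F. The complement of L sees only N, while AAᵀ is bounded below on L. The eigenspace U_t is
therefore off by at most a constant times min(1, ‖N‖²‖W⁻¹‖²), W being the leading r₀ × r₀ block of
Z^F (`trace_one_sub_le_lossBound`). The expectation of ‖N‖² is of order 1/q, but ‖W⁻¹‖² is not
integrable. One entry of W⁻¹, as a function of the matching entry x of W, has the form 1/(x + b),
and a bounded density gives E min(1, τ²/(x + b)²) ≤ 7τ. With τ² = 1/q this yields an expected loss
of order q^{-1/2} (`lintegral_lossBound_le`).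

The average of U_t U_tᵀ then has mass at most the mean loss outside the range of V. On that range it
is bounded below, since K_t K_tᵀ controls the direction of the first column of the Gaussian factor
matrix, and these uniform directions average to I/p₀ by Chebyshev (`frame_average_ge`). The trace
inequality `IsLeadingEigenvectors.mul_trace_le` bounds the angle between the new estimate and V
(`frobSq_defect_le_average`), and an orthogonal Procrustes argument turns it into a rotation.

The bound obtained is q^{-1/2}; the T^{-1} in the rate is slack, T → ∞ serving only the law of large
numbers. The second claim is the first one for the transposed model. -/

lemma frobSq_nonneg (A : Matrix (Fin m) (Fin k) ℝ) : 0 ≤ frobSq A :=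
  Finset.sum_nonneg fun _ _ => Finset.sum_nonneg fun _ _ => sq_nonneg _

lemma frobSq_eq_trace (A : Matrix (Fin m) (Fin k) ℝ) :
    frobSq A = (A.transpose * A).trace := by
  simp only [frobSq, Matrix.trace, Matrix.diag, Matrix.mul_apply, Matrix.transpose_apply]
  rw [Finset.sum_comm]
  simp [sq]

lemma frobSq_transpose (A : Matrix (Fin m) (Fin k) ℝ) : frobSq A.transpose = frobSq A := by
  simp only [frobSq, Matrix.transpose_apply]
  rw [Finset.sum_comm]

lemma frobSq_eq_trace' (A : Matrix (Fin m) (Fin k) ℝ) :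
    frobSq A = (A * A.transpose).trace := by
  rw [← frobSq_transpose, frobSq_eq_trace, Matrix.transpose_transpose]

lemma frobSq_smul (c : ℝ) (A : Matrix (Fin m) (Fin k) ℝ) :
    frobSq (c • A) = c ^ 2 * frobSq A := by
  simp [frobSq, mul_pow, Finset.mul_sum]

lemma frobSq_sub_le (A B : Matrix (Fin m) (Fin k) ℝ) :
    frobSq (A - B) ≤ 2 * frobSq A + 2 * frobSq B := by
  simp only [frobSq, Finset.mul_sum, ← Finset.sum_add_distrib]
  refine Finset.sum_le_sum fun i _ => Finset.sum_le_sum fun j _ => ?_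
  rw [Matrix.sub_apply]
  nlinarith [sq_nonneg (A i j + B i j)]

lemma dotProduct_self_nonneg' (x : Fin m → ℝ) : 0 ≤ x ⬝ᵥ x :=
  Finset.sum_nonneg fun _ _ => mul_self_nonneg _

lemma dotProduct_sq_le (x y : Fin m → ℝ) : (x ⬝ᵥ y) ^ 2 ≤ (x ⬝ᵥ x) * (y ⬝ᵥ y) := by
  simpa [dotProduct, sq] using Finset.sum_mul_sq_le_sq_mul_sq Finset.univ x y

lemma mulVec_dotProduct_mulVec (A : Matrix (Fin m) (Fin k) ℝ) (B : Matrix (Fin m) (Fin l) ℝ)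
    (x : Fin k → ℝ) (y : Fin l → ℝ) :
    (A.mulVec x) ⬝ᵥ (B.mulVec y) = x ⬝ᵥ ((A.transpose * B).mulVec y) := by
  rw [← Matrix.mulVec_mulVec, Matrix.dotProduct_mulVec x, Matrix.vecMul_transpose]

lemma dotProduct_mulVec_transpose (A : Matrix (Fin m) (Fin k) ℝ) (x : Fin m → ℝ)
    (y : Fin k → ℝ) : x ⬝ᵥ (A.mulVec y) = (A.transpose.mulVec x) ⬝ᵥ y := by
  rw [Matrix.dotProduct_mulVec, ← Matrix.mulVec_transpose]

lemma mulVec_sq_le_frobSq (A : Matrix (Fin m) (Fin k) ℝ) (x : Fin k → ℝ) :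
    (A.mulVec x) ⬝ᵥ (A.mulVec x) ≤ frobSq A * (x ⬝ᵥ x) := by
  rw [frobSq, Finset.sum_mul]
  refine Finset.sum_le_sum fun i _ => ?_
  have := dotProduct_sq_le (A i) x
  simpa [Matrix.mulVec, dotProduct, sq] using this

/-- The operator-norm bound on A is applied to each column of B. -/
lemma frobSq_mul_le_of_mulVec_le {c : ℝ} {A : Matrix (Fin m) (Fin k) ℝ}
    (h : ∀ x, (A.mulVec x) ⬝ᵥ (A.mulVec x) ≤ c * (x ⬝ᵥ x)) (B : Matrix (Fin k) (Fin l) ℝ) :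
    frobSq (A * B) ≤ c * frobSq B := by
  have key : ∀ {n : ℕ} (M : Matrix (Fin n) (Fin l) ℝ),
      frobSq M = ∑ j, (fun i => M i j) ⬝ᵥ (fun i => M i j) := by
    intro n M
    rw [frobSq, Finset.sum_comm]
    simp [dotProduct, sq]
  rw [key, key, Finset.mul_sum]
  exact Finset.sum_le_sum fun j _ => h fun i => B i j

/-- Squared triangle inequality, as a lower bound. -/
lemma add_dotProduct_add_ge (x y : Fin m → ℝ) :
    (x ⬝ᵥ x) / 2 - y ⬝ᵥ y ≤ (x + y) ⬝ᵥ (x + y) := by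
  simp only [dotProduct, Finset.sum_div, ← Finset.sum_sub_distrib]
  refine Finset.sum_le_sum fun i _ => ?_
  simp only [Pi.add_apply]
  -- The difference of the two sides is (x + 2y)²/2.
  nlinarith [sq_nonneg (x i + 2 * y i)]

lemma frame_dotProduct {K : Matrix (Fin m) (Fin k) ℝ} (hK : K.transpose * K = 1)
    (x : Fin k → ℝ) : (K.mulVec x) ⬝ᵥ (K.mulVec x) = x ⬝ᵥ x := by
  rw [mulVec_dotProduct_mulVec, hK, Matrix.one_mulVec]

/-- Bessel's inequality: with y = Kᵀx, Cauchy–Schwarz applied to y·y = x·Ky gives |y|² ≤ |x||y|. -/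
lemma frame_transpose_dotProduct_le {K : Matrix (Fin m) (Fin k) ℝ} (hK : K.transpose * K = 1)
    (x : Fin m → ℝ) : (K.transpose.mulVec x) ⬝ᵥ (K.transpose.mulVec x) ≤ x ⬝ᵥ x := by
  set y := K.transpose.mulVec x with hy
  have h1 : y ⬝ᵥ y = x ⬝ᵥ K.mulVec y := (dotProduct_mulVec_transpose K x y).symm
  have h2 := dotProduct_sq_le x (K.mulVec y)
  rw [frame_dotProduct hK, ← h1] at h2
  have := dotProduct_self_nonneg' y
  have := dotProduct_self_nonneg' x
  by_contra hlt
  push Not at hlt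
  nlinarith

lemma frobSq_frame {K : Matrix (Fin m) (Fin k) ℝ} (hK : K.transpose * K = 1) :
    frobSq K = k := by
  rw [frobSq_eq_trace, hK]; simp

/-- A lower bound on a square matrix passes to its transpose. -/
lemma transpose_mulVec_ge {s : ℝ} (hs : 0 < s) {A : Matrix (Fin m) (Fin m) ℝ}
    (h : ∀ x, s * (x ⬝ᵥ x) ≤ (A.mulVec x) ⬝ᵥ (A.mulVec x)) (x : Fin m → ℝ) :
    s * (x ⬝ᵥ x) ≤ (A.transpose.mulVec x) ⬝ᵥ (A.transpose.mulVec x) := by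
  have hinj : Function.Injective A.mulVecLin := by
    rw [← LinearMap.ker_eq_bot, LinearMap.ker_eq_bot']
    intro y hy
    have h1 := h y
    rw [Matrix.mulVecLin_apply] at hy
    rw [hy, dotProduct_zero] at h1
    have h2 : y ⬝ᵥ y = 0 := le_antisymm (by nlinarith) (dotProduct_self_nonneg' y)
    exact dotProduct_self_eq_zero.mp h2
  -- With x = Ay one has |x|⁴ = (y·Aᵀx)² ≤ |y|²|Aᵀx|², and s|y|² ≤ |x|².
  obtain ⟨y, hy⟩ := (LinearMap.injective_iff_surjective.mp hinj) x
  rw [Matrix.mulVecLin_apply] at hy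
  have h1 := h y
  have h2 := dotProduct_sq_le y (A.transpose.mulVec x)
  rw [dotProduct_comm, ← dotProduct_mulVec_transpose, hy] at h2
  rw [hy] at h1
  have hx := dotProduct_self_nonneg' x
  have hy0 := dotProduct_self_nonneg' y
  have hA := dotProduct_self_nonneg' (A.transpose.mulVec x)
  rcases hx.eq_or_lt with h0 | h0
  · rw [← h0]; simpa using hA
  · have : s * (x ⬝ᵥ x) ^ 2 ≤ (x ⬝ᵥ x) * ((A.transpose.mulVec x) ⬝ᵥ (A.transpose.mulVec x)) := by
      nlinarith
    by_contra hlt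
    push Not at hlt
    nlinarith

end FrobeniusNorm

/-! ### Polar decomposition and the Procrustes bound. -/

section Procrustes

variable {m k : ℕ}

lemma transpose_mul_self_posSemidef (A : Matrix (Fin m) (Fin k) ℝ) :
    (A.transpose * A).PosSemidef := by
  simpa [Matrix.conjTranspose_eq_transpose_of_trivial] using
    Matrix.posSemidef_conjTranspose_mul_self A

/-- Polar decomposition of an injective matrix. -/
lemma exists_polar (G : Matrix (Fin m) (Fin k) ℝ) (hG : (G.transpose * G).PosDef) :
    ∃ (K : Matrix (Fin m) (Fin k) ℝ) (S : Matrix (Fin k) (Fin k) ℝ),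
      K.transpose * K = 1 ∧ S.PosSemidef ∧ G = K * S ∧
      S * S = G.transpose * G := by
  set M := G.transpose * G with hM
  have hS : (CFC.sqrt M).PosSemidef := Matrix.nonneg_iff_posSemidef.mp (CFC.sqrt_nonneg M)
  have hSS : CFC.sqrt M * CFC.sqrt M = M := CFC.sqrt_mul_sqrt_self M hG.posSemidef.nonneg
  set S := CFC.sqrt M
  have hdet : IsUnit S.det := by
    have h1 : IsUnit M.det := (Matrix.isUnit_iff_isUnit_det _).mp hG.isUnit
    rw [← hSS, Matrix.det_mul] at h1
    exact isUnit_of_mul_isUnit_left h1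
  have hST : S.transpose = S := by
    have := hS.isHermitian.eq
    rwa [Matrix.conjTranspose_eq_transpose_of_trivial] at this
  refine ⟨G * S⁻¹, S, ?_, hS, ?_, hSS⟩
  · rw [Matrix.transpose_mul, Matrix.transpose_nonsing_inv, hST, Matrix.mul_assoc,
      ← Matrix.mul_assoc G.transpose, ← hM, ← hSS, Matrix.mul_assoc,
      Matrix.mul_nonsing_inv _ hdet, Matrix.mul_one, Matrix.nonsing_inv_mul _ hdet]
  · rw [Matrix.mul_assoc, Matrix.nonsing_inv_mul _ hdet, Matrix.mul_one]

lemma posSemidef_of_dotProduct {M : Matrix (Fin k) (Fin k) ℝ} (hM : M.transpose = M)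
    (h : ∀ x, 0 ≤ x ⬝ᵥ M.mulVec x) : M.PosSemidef := by
  rw [Matrix.posSemidef_iff_dotProduct_mulVec]
  exact ⟨by rwa [Matrix.IsHermitian, Matrix.conjTranspose_eq_transpose_of_trivial],
    fun x => by simpa using h x⟩

lemma Matrix.PosSemidef.transpose_eq {M : Matrix (Fin k) (Fin k) ℝ} (hM : M.PosSemidef) :
    M.transpose = M := by
  have := hM.isHermitian.eq
  rwa [Matrix.conjTranspose_eq_transpose_of_trivial] at this

lemma Matrix.PosSemidef.dotProduct_nonneg {M : Matrix (Fin k) (Fin k) ℝ} (hM : M.PosSemidef)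
    (x : Fin k → ℝ) : 0 ≤ x ⬝ᵥ M.mulVec x := by
  simpa using (Matrix.posSemidef_iff_dotProduct_mulVec.mp hM).2 x

lemma Matrix.PosSemidef.sqrt_mul_self {M : Matrix (Fin k) (Fin k) ℝ} (hM : M.PosSemidef) :
    CFC.sqrt M * CFC.sqrt M = M := CFC.sqrt_mul_sqrt_self M hM.nonneg

lemma sqrt_transpose (M : Matrix (Fin k) (Fin k) ℝ) :
    (CFC.sqrt M).transpose = CFC.sqrt M :=
  (Matrix.nonneg_iff_posSemidef.mp (CFC.sqrt_nonneg M)).transpose_eq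

lemma Matrix.PosSemidef.dotProduct_le_trace {M : Matrix (Fin k) (Fin k) ℝ} (hM : M.PosSemidef)
    (x : Fin k → ℝ) : x ⬝ᵥ M.mulVec x ≤ M.trace * (x ⬝ᵥ x) := by
  have h := mulVec_sq_le_frobSq (CFC.sqrt M) x
  rwa [mulVec_dotProduct_mulVec, frobSq_eq_trace, sqrt_transpose, hM.sqrt_mul_self] at h

/-- A positive semidefinite contraction satisfies S ≤ 1, and tr S - tr S² is the trace of √S(1 -
S)√S. -/
lemma trace_sq_le_trace {S : Matrix (Fin k) (Fin k) ℝ} (hS : S.PosSemidef)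
    (h1 : ∀ x, (S.mulVec x) ⬝ᵥ (S.mulVec x) ≤ x ⬝ᵥ x) : (S * S).trace ≤ S.trace := by
  have hle : (1 - S).PosSemidef := by
    refine posSemidef_of_dotProduct (by simp [hS.transpose_eq]) fun x => ?_
    rw [Matrix.sub_mulVec, Matrix.one_mulVec, dotProduct_sub]
    have h2 := dotProduct_sq_le x (S.mulVec x)
    have h3 := h1 x
    have h4 := dotProduct_self_nonneg' x
    nlinarith [hS.dotProduct_nonneg x, dotProduct_self_nonneg' (S.mulVec x)]
  have h2 := (hle.conjTranspose_mul_mul_same (CFC.sqrt S)).trace_nonneg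
  rw [Matrix.conjTranspose_eq_transpose_of_trivial, sqrt_transpose, Matrix.mul_sub, Matrix.mul_one,
    Matrix.sub_mul, hS.sqrt_mul_self, Matrix.trace_sub, Matrix.trace_mul_cycle,
    hS.sqrt_mul_self] at h2
  linarith

/-- The orthogonal Procrustes problem: two orthonormal frames are close, up to a rotation, if
their column spaces are close. -/
lemma exists_orthogonal_frobSq_sub_le {U V : Matrix (Fin m) (Fin k) ℝ}
    (hU : U.transpose * U = 1) (hV : V.transpose * V = 1) :
    ∃ H ∈ Matrix.orthogonalGroup (Fin k) ℝ,
      frobSq (U - V * H) ≤ (4 * k + 2) * (k - frobSq (V.transpose * U)) := by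
  set A := V.transpose * U with hA
  have hcontr : ∀ x, (A.mulVec x) ⬝ᵥ (A.mulVec x) ≤ x ⬝ᵥ x := by
    intro x
    rw [hA, ← Matrix.mulVec_mulVec]
    exact (frame_transpose_dotProduct_le hV _).trans_eq (frame_dotProduct hU x)
  have hdef : (1 - A.transpose * A).PosSemidef := by
    refine posSemidef_of_dotProduct (by simp) fun x => ?_
    rw [Matrix.sub_mulVec, Matrix.one_mulVec, dotProduct_sub, ← mulVec_dotProduct_mulVec]
    linarith [hcontr x]
  have htr : (1 - A.transpose * A).trace = k - frobSq A := by
    rw [Matrix.trace_sub, frobSq_eq_trace]; simp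
  have hnn : 0 ≤ k - frobSq A := htr ▸ hdef.trace_nonneg
  -- If A = VᵀU is invertible, its orthogonal polar factor is the rotation and ‖U - VK‖² = 2k - 2 tr
  -- S ≤ 2(k - ‖A‖²). Otherwise the defect k - ‖A‖² is at least 1 and the trivial bound ‖U - V‖² ≤
  -- 4k suffices; this accounts for the constant 4k + 2.
  by_cases hpd : (A.transpose * A).PosDef
  · obtain ⟨K, S, hK, hS, hAKS, hSS⟩ := exists_polar A hpd
    refine ⟨K, (Matrix.mem_orthogonalGroup_iff' _ _).mpr hK, ?_⟩
    have hVK : (V * K).transpose * (V * K) = 1 := by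
      rw [Matrix.transpose_mul, Matrix.mul_assoc, ← Matrix.mul_assoc V.transpose, hV,
        Matrix.one_mul, hK]
    have hcross : ((V * K).transpose * U) = S := by
      rw [Matrix.transpose_mul, Matrix.mul_assoc, ← hA, hAKS, ← Matrix.mul_assoc, hK,
        Matrix.one_mul]
    have hcross' : U.transpose * (V * K) = S := by
      rw [← hS.transpose_eq, ← hcross, Matrix.transpose_mul, Matrix.transpose_transpose]
    have hexp : frobSq (U - V * K) = 2 * k - 2 * S.trace := by
      rw [frobSq_eq_trace, Matrix.transpose_sub, Matrix.sub_mul, Matrix.mul_sub, Matrix.mul_sub,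
        hU, hVK, hcross, hcross']
      simp only [Matrix.trace_sub, Matrix.trace_one, Fintype.card_fin]
      ring
    have hS1 := trace_sq_le_trace hS fun x => by
      have := hcontr x
      rwa [mulVec_dotProduct_mulVec, ← hSS, ← hS.transpose_eq, ← mulVec_dotProduct_mulVec,
        hS.transpose_eq] at this
    rw [hSS, ← frobSq_eq_trace] at hS1
    rw [hexp]
    nlinarith [mul_nonneg (Nat.cast_nonneg (α := ℝ) k) hnn]
  · refine ⟨1, one_mem _, ?_⟩
    -- On a null vector of A the form of 1 - AᵀA equals |x|², and it is at most its trace times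
    -- |x|².
    have h1 : 1 ≤ k - frobSq A := by
      rw [Matrix.posDef_iff_dotProduct_mulVec] at hpd
      push Not at hpd
      obtain ⟨x, hx0, hx⟩ := hpd (by simpa using
        Matrix.isHermitian_conjTranspose_mul_self A)
      rw [star_trivial] at hx
      have hx1 : 0 < x ⬝ᵥ x := lt_of_le_of_ne (dotProduct_self_nonneg' x)
        fun h => hx0 (dotProduct_self_eq_zero.mp h.symm)
      have h2 := hdef.dotProduct_le_trace x
      rw [htr, Matrix.sub_mulVec, Matrix.one_mulVec, dotProduct_sub] at h2
      by_contra hlt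
      push Not at hlt
      nlinarith
    have h2 := frobSq_sub_le U V
    rw [frobSq_frame hU, frobSq_frame hV] at h2
    rw [Matrix.mul_one]
    have : (0 : ℝ) ≤ k := Nat.cast_nonneg k
    nlinarith

end Procrustes

/-! ### Leading eigenvectors: Courant–Fischer, the trace inequality and low-rank perturbation. -/

section Eigenvectors

variable {m k l a b : ℕ}

/-- Positive scalars only rescale the eigenvalues; this is how the radius and ‖Z_t‖ leave the
problem. -/
lemma IsLeadingEigenvectors.of_smul {A : Matrix (Fin m) (Fin m) ℝ} {U : Matrix (Fin m) (Fin k) ℝ}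
    {s : ℝ} (hs : 0 < s) (h : IsLeadingEigenvectors (s • A) U) : IsLeadingEigenvectors A U := by
  obtain ⟨hk, V, d, hV, hd, hA, hU⟩ := h
  refine ⟨hk, V, s⁻¹ • d, hV, fun i j hij => ?_, ?_, hU⟩
  · simpa using mul_le_mul_of_nonneg_left (hd hij) (inv_nonneg.mpr hs.le)
  · rw [Matrix.diagonal_smul, Matrix.mul_smul, Matrix.smul_mul, ← hA, smul_smul,
      inv_mul_cancel₀ hs.ne', one_smul]

lemma submatrix_castLE_frame {V : Matrix (Fin m) (Fin m) ℝ}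
    (hV : V.transpose * V = 1) (hk : k ≤ m) {U : Matrix (Fin m) (Fin k) ℝ}
    (hU : ∀ i j, U i j = V i (Fin.castLE hk j)) : U.transpose * U = 1 := by
  ext i j
  have := congrFun (congrFun hV (Fin.castLE hk i)) (Fin.castLE hk j)
  simp only [Matrix.mul_apply, Matrix.transpose_apply, hU] at this ⊢
  rw [this]
  simp [Matrix.one_apply]

lemma IsLeadingEigenvectors.frame {A : Matrix (Fin m) (Fin m) ℝ} {U : Matrix (Fin m) (Fin k) ℝ}
    (h : IsLeadingEigenvectors A U) : U.transpose * U = 1 := by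
  obtain ⟨hk, V, d, hV, -, -, hU⟩ := h
  exact submatrix_castLE_frame ((Matrix.mem_orthogonalGroup_iff' _ _).mp hV) hk hU

/-- One half of the Courant–Fischer principle. -/
lemma le_eigenvalue_of_frame {V : Matrix (Fin m) (Fin m) ℝ} {d : Fin m → ℝ}
    (hV : V * V.transpose = 1) (hd : Antitone d) {L : Matrix (Fin m) (Fin k) ℝ}
    (hL : L.transpose * L = 1) {lam : ℝ}
    (hlam : ∀ w, lam * (w ⬝ᵥ w) ≤
      (L.mulVec w) ⬝ᵥ ((V * Matrix.diagonal d * V.transpose).mulVec (L.mulVec w)))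
    (hk : k ≤ m) (j : Fin k) : lam ≤ d (Fin.castLE hk j) := by
  -- k unknowns against j < k equations: some w ≠ 0 makes Lw orthogonal to the first j eigenvectors.
  let f : (Fin k → ℝ) →ₗ[ℝ] (Fin j → ℝ) :=
    (LinearMap.funLeft ℝ ℝ (fun i : Fin j => Fin.castLE (j.2.le.trans hk) i)) ∘ₗ
      (V.transpose * L).mulVecLin
  have hf : LinearMap.ker f ≠ ⊥ := LinearMap.ker_ne_bot_of_finrank_lt (by simp)
  obtain ⟨w, hw, hw0⟩ := (Submodule.ne_bot_iff _).mp hf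
  set y := (V.transpose * L).mulVec w with hy
  have hyz : ∀ i : Fin m, i < Fin.castLE hk j → y i = 0 := by
    intro i hi
    have := congrFun (LinearMap.mem_ker.mp hw) ⟨i, hi⟩
    exact this
  have hyy : y ⬝ᵥ y = w ⬝ᵥ w := by
    rw [hy, mulVec_dotProduct_mulVec, Matrix.transpose_mul, Matrix.transpose_transpose,
      Matrix.mul_assoc, ← Matrix.mul_assoc V, hV, Matrix.one_mul, hL, Matrix.one_mulVec]
  have hw1 : 0 < w ⬝ᵥ w := lt_of_le_of_ne (dotProduct_self_nonneg' w)
    fun h => hw0 (dotProduct_self_eq_zero.mp h.symm)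
  have h1 := hlam w
  have h2 : (L.mulVec w) ⬝ᵥ ((V * Matrix.diagonal d * V.transpose).mulVec (L.mulVec w)) =
      ∑ i, d i * y i ^ 2 := by
    rw [← Matrix.mulVec_mulVec, ← Matrix.mulVec_mulVec, dotProduct_mulVec_transpose V,
      Matrix.mulVec_mulVec, ← hy]
    simp only [dotProduct, Matrix.mulVec_diagonal]
    exact Finset.sum_congr rfl fun i _ => by ring
  have h3 : ∑ i, d i * y i ^ 2 ≤ d (Fin.castLE hk j) * (y ⬝ᵥ y) := by
    rw [dotProduct, Finset.mul_sum]
    refine Finset.sum_le_sum fun i _ => ?_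
    rcases lt_or_ge i (Fin.castLE hk j) with hi | hi
    · simp [hyz i hi]
    · rw [← sq]
      exact mul_le_mul_of_nonneg_right (hd hi) (sq_nonneg _)
  rw [h2] at h1
  rw [hyy] at h3
  exact le_of_mul_le_mul_right (h1.trans h3) hw1

/-- If a positive semidefinite `M` is at least `lam` on a `k`-dimensional subspace, the
part of its leading `k` eigenvectors outside the range of a projection `Q` is controlled by the
part of `M` outside that range. -/
lemma IsLeadingEigenvectors.mul_trace_le {M : Matrix (Fin m) (Fin m) ℝ}
    {U : Matrix (Fin m) (Fin k) ℝ} (hMU : IsLeadingEigenvectors M U) (hM : M.PosSemidef)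
    {L : Matrix (Fin m) (Fin k) ℝ} (hL : L.transpose * L = 1) {lam : ℝ}
    (hlam : ∀ w, lam * (w ⬝ᵥ w) ≤ (L.mulVec w) ⬝ᵥ (M.mulVec (L.mulVec w)))
    {P : Matrix (Fin m) (Fin m) ℝ} (hPT : P.transpose = P) (hPP : P * P = P) :
    lam * (P * (U * U.transpose)).trace ≤ (P * M).trace := by
  obtain ⟨hk, V, d, hV, hd, rfl, hU⟩ := hMU
  have hV1 := (Matrix.mem_orthogonalGroup_iff _ _).mp hV
  have hV2 := (Matrix.mem_orthogonalGroup_iff' _ _).mp hV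
  change V * V.transpose = 1 at hV1
  change V.transpose * V = 1 at hV2
  -- In the eigenbasis tr(PM) = Σ Wᵢᵢ dᵢ, and tr(PUUᵀ) is the sum of the first k entries Wᵢᵢ. There
  -- dᵢ ≥ lam by Courant–Fischer, and all other terms are nonnegative.
  set W := V.transpose * P * V with hW
  have hWnn : ∀ i, 0 ≤ W i i := by
    intro i
    have : W = (P * V).transpose * (P * V) := by
      rw [Matrix.transpose_mul, hPT, Matrix.mul_assoc, ← Matrix.mul_assoc P, hPP,
        ← Matrix.mul_assoc]
    rw [this, Matrix.mul_apply]
    exact Finset.sum_nonneg fun j _ => mul_self_nonneg _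
  have hdnn : ∀ i, 0 ≤ d i := by
    intro i
    have h1 := hM.dotProduct_nonneg (V.mulVec (Pi.single i 1))
    rw [← Matrix.mulVec_mulVec, ← Matrix.mulVec_mulVec, dotProduct_mulVec_transpose V,
      Matrix.mulVec_mulVec, hV2, Matrix.one_mulVec] at h1
    simpa using h1
  have h1 : (P * (V * Matrix.diagonal d * V.transpose)).trace = ∑ i, W i i * d i := by
    rw [← Matrix.mul_assoc, ← Matrix.mul_assoc, Matrix.trace_mul_comm, ← Matrix.mul_assoc,
      ← Matrix.mul_assoc, ← hW]
    simp [Matrix.trace, Matrix.mul_diagonal]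
  have h2 : (P * (U * U.transpose)).trace = ∑ j, W (Fin.castLE hk j) (Fin.castLE hk j) := by
    rw [← Matrix.mul_assoc, Matrix.trace_mul_comm, ← Matrix.mul_assoc]
    simp only [Matrix.trace, Matrix.diag, hW, Matrix.mul_apply, Matrix.transpose_apply, hU]
  rw [h1, h2, Finset.mul_sum]
  calc ∑ j, lam * W (Fin.castLE hk j) (Fin.castLE hk j)
      ≤ ∑ j, W (Fin.castLE hk j) (Fin.castLE hk j) * d (Fin.castLE hk j) := by
        refine Finset.sum_le_sum fun j _ => ?_
        rw [mul_comm]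
        exact mul_le_mul_of_nonneg_left (le_eigenvalue_of_frame hV1 hd hL hlam hk j) (hWnn _)
    _ = ∑ i ∈ Finset.univ.map (Fin.castLEEmb hk), W i i * d i := by
        rw [Finset.sum_map]; rfl
    _ ≤ ∑ i, W i i * d i :=
        Finset.sum_le_sum_of_subset_of_nonneg (Finset.subset_univ _)
          fun i _ _ => mul_nonneg (hWnn i) (hdnn i)

lemma one_sub_frame_transpose (L : Matrix (Fin m) (Fin k) ℝ) :
    (1 - L * L.transpose).transpose = 1 - L * L.transpose := by
  simp

lemma one_sub_frame_sq {L : Matrix (Fin m) (Fin k) ℝ} (hL : L.transpose * L = 1) :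
    (1 - L * L.transpose) * (1 - L * L.transpose) = 1 - L * L.transpose := by
  have : L * L.transpose * (L * L.transpose) = L * L.transpose := by
    rw [Matrix.mul_assoc, ← Matrix.mul_assoc L.transpose, hL, Matrix.one_mul]
  simp only [Matrix.sub_mul, Matrix.mul_sub, Matrix.one_mul, Matrix.mul_one, this, sub_self,
    sub_zero]

lemma frame_mul {V : Matrix (Fin m) (Fin a) ℝ} (hV : V.transpose * V = 1)
    {K : Matrix (Fin a) (Fin k) ℝ} (hK : K.transpose * K = 1) :
    (V * K).transpose * (V * K) = 1 := by
  rw [Matrix.transpose_mul, Matrix.mul_assoc, ← Matrix.mul_assoc V.transpose, hV, Matrix.one_mul,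
    hK]

lemma trace_proj_mul_eq_frobSq {P : Matrix (Fin m) (Fin m) ℝ} (hPT : P.transpose = P)
    (hPP : P * P = P) (A : Matrix (Fin m) (Fin k) ℝ) :
    (P * (A * A.transpose)).trace = frobSq (P * A) := by
  rw [frobSq_eq_trace, Matrix.transpose_mul, hPT, Matrix.mul_assoc, ← Matrix.mul_assoc P P, hPP,
    ← Matrix.mul_assoc, Matrix.trace_mul_comm]

/-- When L is a frame too, this is the mass of U outside its range; for equal dimensions, the sum of
squared sines of the principal angles. It measures subspace distance throughout. -/
lemma trace_one_sub_frame {L : Matrix (Fin m) (Fin a) ℝ} {U : Matrix (Fin m) (Fin k) ℝ}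
    (hU : U.transpose * U = 1) :
    ((1 - L * L.transpose) * (U * U.transpose)).trace = k - frobSq (L.transpose * U) := by
  rw [Matrix.sub_mul, Matrix.one_mul, Matrix.trace_sub, ← frobSq_eq_trace', frobSq_frame hU,
    frobSq_eq_trace', Matrix.transpose_mul, Matrix.transpose_transpose, Matrix.mul_assoc,
    Matrix.trace_mul_comm L]
  simp only [Matrix.mul_assoc]

/-- The leading eigenvectors of a perturbed low-rank Gram matrix. -/
lemma trace_one_sub_le_min {V : Matrix (Fin m) (Fin a) ℝ} (hV : V.transpose * V = 1)
    (G : Matrix (Fin a) (Fin b) ℝ) (N : Matrix (Fin m) (Fin b) ℝ)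
    {U : Matrix (Fin m) (Fin k) ℝ}
    (hU : IsLeadingEigenvectors ((V * G + N) * (V * G + N).transpose) U)
    {K : Matrix (Fin a) (Fin k) ℝ} (hK : K.transpose * K = 1) (hKG : K * K.transpose * G = G)
    {s : ℝ} (hs : 0 < s)
    (hsK : ∀ w, s * (w ⬝ᵥ w) ≤ ((G.transpose * K).mulVec w) ⬝ᵥ ((G.transpose * K).mulVec w)) :
    ((1 - V * K * (V * K).transpose) * (U * U.transpose)).trace ≤
      k * min 1 (4 * frobSq N / s) := by
  set A := V * G + N with hA
  set L := V * K with hLdef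
  have hL : L.transpose * L = 1 := frame_mul hV hK
  have hPT := one_sub_frame_transpose L
  have hPP := one_sub_frame_sq hL
  set P := 1 - L * L.transpose with hP
  have hk0 : (0 : ℝ) ≤ k := Nat.cast_nonneg k
  have hN0 := frobSq_nonneg N
  have hone : (P * (U * U.transpose)).trace ≤ k := by
    rw [trace_one_sub_frame hU.frame]
    linarith [frobSq_nonneg (L.transpose * U)]
  have hnn : 0 ≤ (P * (U * U.transpose)).trace := by
    rw [trace_proj_mul_eq_frobSq hPT hPP]; exact frobSq_nonneg _
  -- The last estimate uses ‖N‖² ≤ k‖N‖², which requires k ≥ 1.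
  rcases k.eq_zero_or_pos with hk | hk
  · refine hone.trans ?_
    simp [hk]
  have hk1 : (1 : ℝ) ≤ k := by exact_mod_cast hk
  rcases lt_or_ge s (4 * frobSq N) with hlt | hge
  · have : 1 ≤ 4 * frobSq N / s := by rw [le_div_iff₀ hs]; linarith
    rwa [min_eq_left this, mul_one]
  rw [mul_min_of_nonneg _ _ hk0, mul_one]
  refine le_min hone ?_
  -- In the remaining case ‖N‖² ≤ s/4, so the form is at least s/2 - ‖N‖² ≥ s/4 on L.
  have hALw : ∀ w, (s / 4) * (w ⬝ᵥ w) ≤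
      (L.mulVec w) ⬝ᵥ ((A * A.transpose).mulVec (L.mulVec w)) := by
    intro w
    rw [← Matrix.mulVec_mulVec (L.mulVec w) A, dotProduct_mulVec_transpose A]
    nth_rewrite 1 2 [hA]
    rw [Matrix.transpose_add, Matrix.add_mulVec]
    have h1 : (V * G).transpose.mulVec (L.mulVec w) = (G.transpose * K).mulVec w := by
      rw [Matrix.mulVec_mulVec, hLdef, Matrix.transpose_mul, Matrix.mul_assoc,
        ← Matrix.mul_assoc V.transpose, hV, Matrix.one_mul]
    rw [h1]
    refine le_trans ?_ (add_dotProduct_add_ge _ _)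
    have h2 := mulVec_sq_le_frobSq N.transpose (L.mulVec w)
    rw [frame_dotProduct hL, frobSq_transpose] at h2
    have h3 := hsK w
    nlinarith [dotProduct_self_nonneg' w]
  have h1 := hU.mul_trace_le (by simpa using transpose_mul_self_posSemidef A.transpose) hL hALw
    hPT hPP
  -- The signal VG lies in the range of L, which P annihilates.
  have h2 : P * A = P * N := by
    have : L * L.transpose * (V * G) = V * G := by
      rw [hLdef, Matrix.transpose_mul]
      calc V * K * (K.transpose * V.transpose) * (V * G)
          = V * (K * K.transpose * ((V.transpose * V) * G)) := by simp only [Matrix.mul_assoc]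
        _ = V * G := by rw [hV, Matrix.one_mul, hKG]
    rw [hA, Matrix.mul_add, hP, Matrix.sub_mul, this, Matrix.one_mul, sub_self, zero_add]
  rw [trace_proj_mul_eq_frobSq hPT hPP A, h2] at h1
  have h3 : frobSq (P * N) ≤ frobSq N := by
    rw [← one_mul (frobSq N)]
    refine frobSq_mul_le_of_mulVec_le (fun x => ?_) N
    rw [mulVec_dotProduct_mulVec, hPT, hPP, hP, Matrix.sub_mulVec, Matrix.one_mulVec,
      dotProduct_sub, one_mul, ← Matrix.mulVec_mulVec, dotProduct_mulVec_transpose]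
    linarith [dotProduct_self_nonneg' (L.transpose.mulVec x)]
  rw [mul_div_assoc', le_div_iff₀ hs]
  nlinarith

end Eigenvectors

/-! ### Averaging the projections over time. -/

section Averaging

variable {m k a T : ℕ}

lemma frobSq_proj_sub_proj {U L : Matrix (Fin m) (Fin k) ℝ} (hU : U.transpose * U = 1)
    (hL : L.transpose * L = 1) :
    frobSq (U * U.transpose - L * L.transpose) =
      2 * ((1 - L * L.transpose) * (U * U.transpose)).trace := by
  have hUU : U * U.transpose * (U * U.transpose) = U * U.transpose := by
    rw [Matrix.mul_assoc, ← Matrix.mul_assoc U.transpose, hU, Matrix.one_mul]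
  have hLL : L * L.transpose * (L * L.transpose) = L * L.transpose := by
    rw [Matrix.mul_assoc, ← Matrix.mul_assoc L.transpose, hL, Matrix.one_mul]
  have tU : (U * U.transpose).trace = k := by rw [← frobSq_eq_trace', frobSq_frame hU]
  have tL : (L * L.transpose).trace = k := by rw [← frobSq_eq_trace', frobSq_frame hL]
  rw [frobSq_eq_trace]
  simp only [Matrix.transpose_sub, Matrix.transpose_mul, Matrix.transpose_transpose,
    Matrix.sub_mul, Matrix.mul_sub, hUU, hLL, Matrix.one_mul, Matrix.trace_sub, tU, tL]
  rw [Matrix.trace_mul_comm (U * U.transpose) (L * L.transpose)]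
  ring

/-- The averaged projection M has mass at most D outside V. On V it is at least lam/4: replacing
each VK_t by U_t halves the form and costs twice the individual loss, leaving lam/2 - 2D. The trace
inequality compares the two. -/
lemma frobSq_defect_le_average (hT : 0 < T) {V : Matrix (Fin m) (Fin a) ℝ}
    (hV : V.transpose * V = 1) {U : Fin T → Matrix (Fin m) (Fin k) ℝ}
    (hU : ∀ t, (U t).transpose * U t = 1) {K : Fin T → Matrix (Fin a) (Fin k) ℝ}
    (hK : ∀ t, (K t).transpose * K t = 1) {D : ℝ} {lam : ℝ} (hlam : 0 < lam)
    (hD : (1 / (T : ℝ)) * ∑ t,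
      ((1 - V * K t * (V * K t).transpose) * (U t * (U t).transpose)).trace ≤ D)
    (hDlam : D ≤ lam / 8)
    (havg : ∀ x : Fin a → ℝ, lam * (x ⬝ᵥ x) ≤
      (1 / (T : ℝ)) * ∑ t, ((K t).transpose.mulVec x) ⬝ᵥ ((K t).transpose.mulVec x))
    {Y : Matrix (Fin m) (Fin a) ℝ}
    (hY : IsLeadingEigenvectors ((1 / (T : ℝ)) • ∑ t, U t * (U t).transpose) Y) :
    a - frobSq (V.transpose * Y) ≤ 4 / lam * D := by
  have hT0 : (0 : ℝ) < 1 / T := by positivity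
  set M := (1 / (T : ℝ)) • ∑ t, U t * (U t).transpose with hM
  have hMx : ∀ x, x ⬝ᵥ M.mulVec x =
      (1 / (T : ℝ)) * ∑ t, ((U t).transpose.mulVec x) ⬝ᵥ ((U t).transpose.mulVec x) := by
    intro x
    rw [hM, Matrix.smul_mulVec, Matrix.sum_mulVec, dotProduct_smul, dotProduct_sum, smul_eq_mul]
    congr 1
    refine Finset.sum_congr rfl fun t _ => ?_
    rw [← Matrix.mulVec_mulVec, dotProduct_mulVec_transpose]
  have hMpsd : M.PosSemidef := by
    refine posSemidef_of_dotProduct (by simp [hM, Matrix.transpose_sum]) fun x => ?_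
    rw [hMx]
    exact mul_nonneg hT0.le (Finset.sum_nonneg fun t _ => dotProduct_self_nonneg' _)
  have hquad : ∀ w, (lam / 4) * (w ⬝ᵥ w) ≤ (V.mulVec w) ⬝ᵥ (M.mulVec (V.mulVec w)) := by
    intro w
    set δ : Fin T → ℝ := fun t =>
      ((1 - V * K t * (V * K t).transpose) * (U t * (U t).transpose)).trace with hδ
    have hw0 := dotProduct_self_nonneg' w
    have hterm : ∀ t, ((K t).transpose.mulVec w) ⬝ᵥ ((K t).transpose.mulVec w) / 2 -
        2 * δ t * (w ⬝ᵥ w) ≤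
        ((U t).transpose.mulVec (V.mulVec w)) ⬝ᵥ ((U t).transpose.mulVec (V.mulVec w)) := by
      intro t
      have hL := frame_mul hV (hK t)
      have h1 := mulVec_sq_le_frobSq
        (U t * (U t).transpose - (V * K t) * (V * K t).transpose) (V.mulVec w)
      rw [frobSq_proj_sub_proj (hU t) hL, frame_dotProduct hV] at h1
      have h2 := add_dotProduct_add_ge (((V * K t) * (V * K t).transpose).mulVec (V.mulVec w))
        ((U t * (U t).transpose - (V * K t) * (V * K t).transpose).mulVec (V.mulVec w))
      rw [← Matrix.add_mulVec, add_sub_cancel] at h2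
      have h3 : ((V * K t) * (V * K t).transpose).mulVec (V.mulVec w) =
          (V * K t).mulVec ((K t).transpose.mulVec w) := by
        rw [← Matrix.mulVec_mulVec, Matrix.mulVec_mulVec w, Matrix.transpose_mul,
          Matrix.mul_assoc, hV, Matrix.mul_one]
      rw [h3, frame_dotProduct hL, ← Matrix.mulVec_mulVec _ (U t), frame_dotProduct (hU t)] at h2
      simp only [hδ]
      linarith
    have hsum := Finset.sum_le_sum fun t (_ : t ∈ Finset.univ) => hterm t
    rw [Finset.sum_sub_distrib, ← Finset.sum_div, ← Finset.sum_mul, ← Finset.mul_sum] at hsum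
    have h1 := mul_le_mul_of_nonneg_left hsum hT0.le
    rw [hMx]
    refine le_trans ?_ h1
    have h2 := havg w
    have h3 : (1 / (T : ℝ)) * ∑ t, δ t ≤ lam / 8 := hD.trans hDlam
    nlinarith [mul_le_mul_of_nonneg_right h3 hw0]
  have hPT := one_sub_frame_transpose V
  have hPP := one_sub_frame_sq hV
  have h1 := hY.mul_trace_le hMpsd hV hquad hPT hPP
  rw [trace_one_sub_frame hY.frame] at h1
  -- The range of VK_t lies inside that of V, so projecting off V leaves less of U_t than projecting
  -- off VK_t; in formulas, K_tᵀ is a contraction.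
  have h2 : ((1 - V * V.transpose) * M).trace ≤ D := by
    refine le_trans ?_ hD
    rw [hM, Matrix.mul_smul, Matrix.trace_smul, smul_eq_mul, Matrix.mul_sum, Matrix.trace_sum]
    refine mul_le_mul_of_nonneg_left (Finset.sum_le_sum fun t _ => ?_) hT0.le
    rw [trace_one_sub_frame (hU t), trace_one_sub_frame (hU t), Matrix.transpose_mul,
      Matrix.mul_assoc]
    have h3 := frobSq_mul_le_of_mulVec_le (c := 1) (A := (K t).transpose)
      (fun x => by rw [one_mul]; exact frame_transpose_dotProduct_le (hK t) x)
      (V.transpose * U t)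
    linarith
  have h3 : 4 / lam * D = D / (lam / 4) := by field_simp
  rw [h3, le_div_iff₀ (by positivity)]
  linarith

end Averaging

/-! ### Singular values, spectral bounds and near-scalar matrices. -/

section Spectrum

variable {m k : ℕ}

/-- On a k-dimensional domain the k-th singular value (index k - 1 when counted from 0) is the
smallest, so its square is the least eigenvalue of A*A; x is expanded in the eigenbasis. -/
lemma singVal_sq_mul_le {k : ℕ} (hk : 0 < k) (A : Matrix (Fin m) (Fin k) ℝ)
    (x : Fin k → ℝ) :
    singVal k A ^ 2 * (x ⬝ᵥ x) ≤ (A.mulVec x) ⬝ᵥ (A.mulVec x) := by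
  set T := Matrix.toEuclideanLin A with hT
  set v : EuclideanSpace ℝ (Fin k) := WithLp.toLp 2 x with hv
  have hn : Module.finrank ℝ (EuclideanSpace ℝ (Fin k)) = k := by simp
  have hS := T.isSymmetric_adjoint_comp_self
  have h1 : (A.mulVec x) ⬝ᵥ (A.mulVec x) = inner ℝ v ((LinearMap.adjoint T ∘ₗ T) v) := by
    rw [LinearMap.comp_apply, LinearMap.adjoint_inner_right, EuclideanSpace.inner_eq_star_dotProduct]
    simp [hT, hv, Matrix.toLpLin_apply]
  have h2 : x ⬝ᵥ x = inner ℝ v v := by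
    rw [EuclideanSpace.inner_eq_star_dotProduct]; simp [hv]
  set e := hS.eigenvectorBasis hn
  rw [h1, h2, ← e.sum_inner_mul_inner v v, ← e.sum_inner_mul_inner v _, Finset.mul_sum]
  refine Finset.sum_le_sum fun i _ => ?_
  have h3 : inner ℝ (e i) ((LinearMap.adjoint T ∘ₗ T) v) =
      hS.eigenvalues hn i * inner ℝ (e i) v := by
    rw [← hS, hS.apply_eigenvectorBasis hn i, inner_smul_left]; simp [e]
  rw [h3]
  have h4 : singVal k A ^ 2 ≤ hS.eigenvalues hn i := by
    rw [singVal, T.sq_singularValues_of_lt hn (i := k - 1) (by omega)]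
    exact hS.eigenvalues_antitone hn (by rw [Fin.le_def]; simp; omega)
  have h5 : 0 ≤ (inner ℝ v (e i) : ℝ) * inner ℝ (e i) v := by
    rw [real_inner_comm]; exact mul_self_nonneg _
  nlinarith

lemma SpectrumIn.posSemidef {A : Matrix (Fin m) (Fin m) ℝ} {c C : ℝ} (hc : 0 ≤ c)
    (h : SpectrumIn A c C) : A.PosSemidef := by
  obtain ⟨hA, h⟩ := h
  exact hA.posSemidef_iff_eigenvalues_nonneg.mpr fun i => hc.trans (h i).1

lemma SpectrumIn.dotProduct_bounds {A : Matrix (Fin m) (Fin m) ℝ} {c C : ℝ}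
    (h : SpectrumIn A c C) (x : Fin m → ℝ) :
    c * (x ⬝ᵥ x) ≤ x ⬝ᵥ A.mulVec x ∧ x ⬝ᵥ A.mulVec x ≤ C * (x ⬝ᵥ x) := by
  obtain ⟨hA, h⟩ := h
  set e := hA.eigenvectorBasis
  set v : EuclideanSpace ℝ (Fin m) := WithLp.toLp 2 x with hv
  set w : EuclideanSpace ℝ (Fin m) := WithLp.toLp 2 (A.mulVec x) with hw
  have h1 : x ⬝ᵥ A.mulVec x = inner ℝ v w := by
    rw [EuclideanSpace.inner_eq_star_dotProduct, dotProduct_comm]; simp [hv, hw]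
  have h2 : x ⬝ᵥ x = inner ℝ v v := by
    rw [EuclideanSpace.inner_eq_star_dotProduct]; simp [hv]
  have h3 : ∀ i, inner ℝ (e i) w = hA.eigenvalues i * inner ℝ (e i) v := by
    intro i
    have h4 := hA.mulVec_eigenvectorBasis i
    have hAT : A.transpose = A := by
      have := hA.eq
      rwa [Matrix.conjTranspose_eq_transpose_of_trivial] at this
    rw [EuclideanSpace.inner_eq_star_dotProduct, EuclideanSpace.inner_eq_star_dotProduct,
      star_trivial]
    simp only [hw, hv]
    rw [dotProduct_comm, dotProduct_mulVec_transpose, hAT, h4, smul_dotProduct, smul_eq_mul,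
      dotProduct_comm]
  have h5 : ∀ i, 0 ≤ (inner ℝ v (e i) : ℝ) * inner ℝ (e i) v := by
    intro i
    rw [real_inner_comm]; exact mul_self_nonneg _
  rw [h1, h2, ← e.sum_inner_mul_inner v v, ← e.sum_inner_mul_inner v w, Finset.mul_sum,
    Finset.mul_sum]
  constructor <;> refine Finset.sum_le_sum fun i _ => ?_ <;> rw [h3] <;>
    nlinarith [h i, h5 i, mul_le_mul_of_nonneg_right (h i).1 (h5 i),
      mul_le_mul_of_nonneg_right (h i).2 (h5 i)]

lemma SpectrumIn.sqrt_bounds {A : Matrix (Fin m) (Fin m) ℝ} {c C : ℝ} (hc : 0 ≤ c)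
    (h : SpectrumIn A c C) (x : Fin m → ℝ) :
    c * (x ⬝ᵥ x) ≤ ((CFC.sqrt A).mulVec x) ⬝ᵥ ((CFC.sqrt A).mulVec x) ∧
      ((CFC.sqrt A).mulVec x) ⬝ᵥ ((CFC.sqrt A).mulVec x) ≤ C * (x ⬝ᵥ x) := by
  rw [mulVec_dotProduct_mulVec, sqrt_transpose, (h.posSemidef hc).sqrt_mul_self]
  exact h.dotProduct_bounds x

/-- The deviation from I/a has a² entries of size at most 1/(2a²), hence Frobenius norm at most
1/(2a), half of the scalar. -/
lemma dotProduct_mulVec_ge_of_near_scalar {a : ℕ} (ha : 0 < a) {M : Matrix (Fin a) (Fin a) ℝ}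
    (hM : ∀ i j, |M i j - (if i = j then 1 / (a : ℝ) else 0)| ≤ 1 / (2 * (a : ℝ) ^ 2))
    (x : Fin a → ℝ) : 1 / (2 * (a : ℝ)) * (x ⬝ᵥ x) ≤ x ⬝ᵥ M.mulVec x := by
  have ha0 : (0 : ℝ) < a := by exact_mod_cast ha
  set N : Matrix (Fin a) (Fin a) ℝ := M - (1 / (a : ℝ)) • 1 with hN
  have hN1 : frobSq N ≤ (1 / (2 * (a : ℝ))) ^ 2 := by
    have h1 : ∀ i j, N i j ^ 2 ≤ (1 / (2 * (a : ℝ) ^ 2)) ^ 2 := by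
      intro i j
      rw [← sq_abs]
      refine pow_le_pow_left₀ (abs_nonneg _) ?_ 2
      simpa [hN, Matrix.one_apply] using hM i j
    calc frobSq N ≤ ∑ _i : Fin a, ∑ _j : Fin a, (1 / (2 * (a : ℝ) ^ 2)) ^ 2 :=
          Finset.sum_le_sum fun i _ => Finset.sum_le_sum fun j _ => h1 i j
      _ = (1 / (2 * (a : ℝ))) ^ 2 := by
          simp only [Finset.sum_const, Finset.card_univ, Fintype.card_fin, nsmul_eq_mul]
          field_simp
  have h2 : x ⬝ᵥ M.mulVec x = 1 / (a : ℝ) * (x ⬝ᵥ x) + x ⬝ᵥ N.mulVec x := by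
    rw [hN, Matrix.sub_mulVec, dotProduct_sub, Matrix.smul_mulVec, Matrix.one_mulVec,
      dotProduct_smul, smul_eq_mul]
    ring
  have hx := dotProduct_self_nonneg' x
  have h3 : |x ⬝ᵥ N.mulVec x| ≤ 1 / (2 * (a : ℝ)) * (x ⬝ᵥ x) := by
    refine abs_le_of_sq_le_sq ?_ (by positivity)
    have h4 := mulVec_sq_le_frobSq N x
    have h5 := dotProduct_sq_le x (N.mulVec x)
    calc (x ⬝ᵥ N.mulVec x) ^ 2 ≤ (x ⬝ᵥ x) * (frobSq N * (x ⬝ᵥ x)) :=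
          h5.trans (mul_le_mul_of_nonneg_left h4 hx)
      _ = frobSq N * (x ⬝ᵥ x) ^ 2 := by ring
      _ ≤ (1 / (2 * (a : ℝ))) ^ 2 * (x ⬝ᵥ x) ^ 2 :=
          mul_le_mul_of_nonneg_right hN1 (sq_nonneg _)
      _ = (1 / (2 * (a : ℝ)) * (x ⬝ᵥ x)) ^ 2 := by ring
  have h6 : 1 / (a : ℝ) = 1 / (2 * (a : ℝ)) + 1 / (2 * (a : ℝ)) := by field_simp; norm_num
  have := (abs_le.mp h3).1
  rw [h2, h6]
  linarith

end Spectrum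

/-! ### Frames of the factor space and their conditioning. -/

section FactorFrame

variable {p₀ q₀ r : ℕ}

/-- The leading `r × r` block. -/
def leadingBlock (h₁ : r ≤ p₀) (h₂ : r ≤ q₀) (Z : Matrix (Fin p₀) (Fin q₀) ℝ) :
    Matrix (Fin r) (Fin r) ℝ :=
  Z.submatrix (Fin.castLE h₁) (Fin.castLE h₂)

/-- 1/‖W⁻¹‖_F² stands in for the squared least singular value: the entries of W⁻¹ are quotients of a
cofactor by the determinant, which can be integrated one variable at a time. -/
lemma dotProduct_le_frobSq_inv_mul {W : Matrix (Fin r) (Fin r) ℝ} (hW : W.det ≠ 0)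
    (x : Fin r → ℝ) : x ⬝ᵥ x ≤ frobSq W⁻¹ * ((W.mulVec x) ⬝ᵥ (W.mulVec x)) := by
  have h := mulVec_sq_le_frobSq W⁻¹ (W.mulVec x)
  rwa [Matrix.mulVec_mulVec, Matrix.nonsing_inv_mul _ (isUnit_iff_ne_zero.mpr hW),
    Matrix.one_mulVec] at h

lemma frobSq_inv_pos (hr : 0 < r) {W : Matrix (Fin r) (Fin r) ℝ} (hW : W.det ≠ 0) :
    0 < frobSq W⁻¹ := by
  by_contra h
  have h1 := dotProduct_le_frobSq_inv_mul hW (Pi.single ⟨0, hr⟩ 1)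
  have h2 := dotProduct_self_nonneg' (W.mulVec (Pi.single ⟨0, hr⟩ 1))
  push Not at h
  have h3 : (Pi.single (⟨0, hr⟩ : Fin r) (1 : ℝ) : Fin r → ℝ) ⬝ᵥ Pi.single ⟨0, hr⟩ 1 = 1 := by
    simp
  rw [h3] at h1
  nlinarith

lemma leadingBlock_mulVec_le (h₁ : r ≤ p₀) (Z : Matrix (Fin p₀) (Fin r) ℝ) (x : Fin r → ℝ) :
    ((leadingBlock h₁ le_rfl Z).mulVec x) ⬝ᵥ ((leadingBlock h₁ le_rfl Z).mulVec x) ≤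
      (Z.mulVec x) ⬝ᵥ (Z.mulVec x) := by
  have h : ∀ i, (leadingBlock h₁ le_rfl Z).mulVec x i = Z.mulVec x (Fin.castLE h₁ i) := by
    intro i
    simp [leadingBlock, Matrix.mulVec, dotProduct]
  simp only [dotProduct, h]
  calc ∑ i, Z.mulVec x (Fin.castLE h₁ i) * Z.mulVec x (Fin.castLE h₁ i)
      = ∑ i ∈ Finset.univ.map (Fin.castLEEmb h₁), Z.mulVec x i * Z.mulVec x i := by
        rw [Finset.sum_map]; rfl
    _ ≤ _ := Finset.sum_le_sum_of_subset_of_nonneg (Finset.subset_univ _)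
        fun _ _ _ => mul_self_nonneg _

lemma leadingBlock_transpose (h₁ : r ≤ p₀) (h₂ : r ≤ q₀) (Z : Matrix (Fin p₀) (Fin q₀) ℝ) :
    leadingBlock h₂ h₁ Z.transpose = (leadingBlock h₁ h₂ Z).transpose := rfl

/-- An orthonormal frame of the column space of a well-conditioned factor matrix. -/
lemma exists_factor_frame (hr : r = min p₀ q₀) (h₁ : r ≤ p₀) (h₂ : r ≤ q₀) (hr0 : 0 < r)
    {Z : Matrix (Fin p₀) (Fin q₀) ℝ} (hW : (leadingBlock h₁ h₂ Z).det ≠ 0)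
    {S : Matrix (Fin p₀) (Fin p₀) ℝ} {c : ℝ} (hc : 0 < c)
    (hS : ∀ x, c * (x ⬝ᵥ x) ≤ (S.mulVec x) ⬝ᵥ (S.mulVec x))
    {B : Matrix (Fin q₀) (Fin q₀) ℝ} {d : ℝ} (hd : 0 < d)
    (hB : ∀ x, d * (x ⬝ᵥ x) ≤ (B.mulVec x) ⬝ᵥ (B.mulVec x)) :
    ∃ K : Matrix (Fin p₀) (Fin r) ℝ, K.transpose * K = 1 ∧
      K * K.transpose * (S * Z) = S * Z ∧
      ∀ w, d * c / frobSq (leadingBlock h₁ h₂ Z)⁻¹ * (w ⬝ᵥ w) ≤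
        (((S * Z * B).transpose * K).mulVec w) ⬝ᵥ (((S * Z * B).transpose * K).mulVec w) := by
  have hpos := frobSq_inv_pos hr0 hW
  have hBT := transpose_mulVec_ge hd hB
  have hST := transpose_mulVec_ge hc hS
  -- If r = p₀ the factor space is everything and K = 1. If r = q₀, S * Z is injective and K is its
  -- polar factor.
  rcases min_choice p₀ q₀ with h | h <;> rw [h] at hr <;> subst hr
  · refine ⟨1, by simp, by simp, fun w => ?_⟩
    have hWT : (leadingBlock h₂ h₁ Z.transpose).det ≠ 0 := by
      rwa [leadingBlock_transpose, Matrix.det_transpose]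
    have e1 := hST w
    have e2 := dotProduct_le_frobSq_inv_mul hWT (S.transpose.mulVec w)
    have e3 := leadingBlock_mulVec_le h₂ Z.transpose (S.transpose.mulVec w)
    have e4 := hBT (Z.transpose.mulVec (S.transpose.mulVec w))
    rw [leadingBlock_transpose, ← Matrix.transpose_nonsing_inv, frobSq_transpose,
      ← leadingBlock_transpose] at e2
    rw [Matrix.mul_one, Matrix.transpose_mul, Matrix.transpose_mul, ← Matrix.mulVec_mulVec,
      ← Matrix.mulVec_mulVec]
    refine le_trans ?_ e4
    rw [mul_div_assoc, mul_assoc]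
    refine mul_le_mul_of_nonneg_left ?_ hd.le
    rw [div_mul_eq_mul_div, div_le_iff₀ hpos]
    nlinarith [mul_le_mul_of_nonneg_left e3 hpos.le]
  · have key : ∀ w, c / frobSq (leadingBlock h₁ h₂ Z)⁻¹ * (w ⬝ᵥ w) ≤
        ((S * Z).mulVec w) ⬝ᵥ ((S * Z).mulVec w) := by
      intro w
      rw [← Matrix.mulVec_mulVec]
      have e1 := hS (Z.mulVec w)
      have e2 := dotProduct_le_frobSq_inv_mul hW w
      have e3 := leadingBlock_mulVec_le h₁ Z w
      refine le_trans ?_ e1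
      rw [div_mul_eq_mul_div, div_le_iff₀ hpos, mul_assoc]
      refine mul_le_mul_of_nonneg_left ?_ hc.le
      nlinarith [mul_le_mul_of_nonneg_left e3 hpos.le]
    have hpd : ((S * Z).transpose * (S * Z)).PosDef := by
      rw [Matrix.posDef_iff_dotProduct_mulVec]
      refine ⟨(transpose_mul_self_posSemidef _).isHermitian, fun x hx => ?_⟩
      rw [star_trivial, ← mulVec_dotProduct_mulVec]
      have hx1 : 0 < x ⬝ᵥ x := lt_of_le_of_ne (dotProduct_self_nonneg' x)
        fun h => hx (dotProduct_self_eq_zero.mp h.symm)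
      exact lt_of_lt_of_le (by positivity) (key x)
    obtain ⟨K, Q, hK, hQ, hKQ, hQQ⟩ := exists_polar _ hpd
    refine ⟨K, hK, ?_, fun w => ?_⟩
    · rw [hKQ, Matrix.mul_assoc, ← Matrix.mul_assoc K.transpose, hK, Matrix.one_mul]
    · have e1 : (S * Z * B).transpose * K = B.transpose * Q := by
        rw [hKQ, Matrix.transpose_mul, Matrix.transpose_mul, hQ.transpose_eq, Matrix.mul_assoc,
          Matrix.mul_assoc, hK, Matrix.mul_one]
      rw [e1, ← Matrix.mulVec_mulVec]
      refine le_trans ?_ (hBT _)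
      rw [mul_div_assoc, mul_assoc]
      refine mul_le_mul_of_nonneg_left ?_ hd.le
      rw [mulVec_dotProduct_mulVec, hQ.transpose_eq, hQQ, ← mulVec_dotProduct_mulVec]
      exact key w

/-- A frame whose range contains `S z` dominates the rank-one direction of `z`. -/
lemma dotProduct_sq_le_frame {K : Matrix (Fin p₀) (Fin r) ℝ} (hK : K.transpose * K = 1)
    {S : Matrix (Fin p₀) (Fin p₀) ℝ} (hS : S.transpose = S) {C : ℝ}
    (hSC : ∀ x, (S.mulVec x) ⬝ᵥ (S.mulVec x) ≤ C * (x ⬝ᵥ x)) {z : Fin p₀ → ℝ}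
    (hz : (K * K.transpose).mulVec (S.mulVec z) = S.mulVec z) (x : Fin p₀ → ℝ) :
    ((S.mulVec x) ⬝ᵥ z) ^ 2 ≤
      C * (z ⬝ᵥ z) * ((K.transpose.mulVec x) ⬝ᵥ (K.transpose.mulVec x)) := by
  have h1 : (S.mulVec x) ⬝ᵥ z =
      (K.transpose.mulVec x) ⬝ᵥ (K.transpose.mulVec (S.mulVec z)) := by
    rw [← dotProduct_mulVec_transpose K, Matrix.mulVec_mulVec, hz, dotProduct_mulVec_transpose, hS]
  rw [h1]
  refine (dotProduct_sq_le _ _).trans ?_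
  rw [mul_comm]
  exact mul_le_mul_of_nonneg_right ((frame_transpose_dotProduct_le hK _).trans (hSC z))
    (dotProduct_self_nonneg' _)

end FactorFrame

/-! ### The deterministic error bound for one update. -/

section Update

variable {p₀ q₀ r p q T : ℕ}

/-- Energy of the projected noise. -/
noncomputable def noiseEnergy (S : Matrix (Fin q) (Fin q) ℝ) (B : Matrix (Fin q) (Fin q₀) ℝ)
    (z : LatentSpace p₀ q₀ p q) : ℝ :=
  frobSq (latentNoise z * (S * B))

/-- Upper bound for the distance between the leading eigenspace of one projected observation and
the factor space. -/
noncomputable def lossBound (h₁ : r ≤ p₀) (h₂ : r ≤ q₀) (κ : ℝ) (S : Matrix (Fin q) (Fin q) ℝ)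
    (B : Matrix (Fin q) (Fin q₀) ℝ) (z : LatentSpace p₀ q₀ p q) : ℝ :=
  r * min 1 (κ * (noiseEnergy S B z / ((q : ℝ) ^ 2 * p)) *
    frobSq (leadingBlock h₁ h₂ (latentFactor z))⁻¹)

/-- The `(i, j)` entry of the projection onto the first column of the factor matrix. -/
noncomputable def columnProj (h : 0 < q₀) (i j : Fin p₀) (z : LatentSpace p₀ q₀ p q) : ℝ :=
  z (Sum.inl (i, ⟨0, h⟩)) * z (Sum.inl (j, ⟨0, h⟩)) / ∑ k, z (Sum.inl (k, ⟨0, h⟩)) ^ 2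

/-- XB = (ρ/‖z‖) q√p A, where A is an orthonormal loading frame times a bounded-size factor, plus
rescaled noise; the prefactor (1/q)(q√p)² is pq. -/
lemma observation_mul_loadingProj (hp : 0 < p) (hq : 0 < q) (R : Matrix (Fin p) (Fin p₀) ℝ)
    (C : Matrix (Fin q) (Fin q₀) ℝ)
    (Sig₁ : Matrix (Fin p₀) (Fin p₀) ℝ) (Sig₂ : Matrix (Fin q₀) (Fin q₀) ℝ)
    (Om₁ : Matrix (Fin p) (Fin p) ℝ) (Om₂ : Matrix (Fin q) (Fin q) ℝ)
    (ρ : ℝ) (z : LatentSpace p₀ q₀ p q) (B : Matrix (Fin q) (Fin q₀) ℝ) :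
    let A := ((1 / Real.sqrt p) • R) *
        (CFC.sqrt Sig₁ * latentFactor z * (CFC.sqrt Sig₂ * ((1 / (q : ℝ)) • (C.transpose * B)))) +
      (1 / (q * Real.sqrt p)) • (CFC.sqrt Om₁ * latentNoise z * (CFC.sqrt Om₂ * B))
    let X := observation R C Sig₁ Sig₂ Om₁ Om₂ ρ z
    X * loadingProj B * X.transpose = ((ρ / ‖z‖) ^ 2 * p * q) • (A * A.transpose) := by
  intro A X
  have hp' : (0 : ℝ) < p := by exact_mod_cast hp
  have hq' : (0 : ℝ) < q := by exact_mod_cast hq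
  have hsp : Real.sqrt p ≠ 0 := (Real.sqrt_pos.mpr hp').ne'
  have h1 : X * B = ((ρ / ‖z‖) * (q * Real.sqrt p)) • A := by
    simp only [X, A, observation, smul_add, Matrix.add_mul, Matrix.smul_mul, Matrix.mul_smul,
      smul_smul, Matrix.mul_assoc]
    congr 1
    · congr 1
      field_simp
    · congr 1
      field_simp
  have h2 : X * loadingProj B * X.transpose = (1 / (q : ℝ)) • ((X * B) * (X * B).transpose) := by
    rw [loadingProj, Matrix.mul_smul, Matrix.smul_mul, Matrix.transpose_mul]
    simp only [Matrix.mul_assoc]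
  rw [h2, h1, Matrix.transpose_smul, Matrix.smul_mul, Matrix.mul_smul, smul_smul, smul_smul]
  congr 1
  have h3 : Real.sqrt p * Real.sqrt p = p := Real.mul_self_sqrt hp'.le
  field_simp
  rw [sq (Real.sqrt p), h3]

/-- The perturbation bound with signal strength s = d c₁²/‖W⁻¹‖². Bounding Ω₁ by C₂ in the noise
gives 4‖N‖²/s at most the argument of the minimum in `lossBound`, with κ = 4C₂/(d c₁²). -/
lemma trace_one_sub_le_lossBound (hr : r = min p₀ q₀) (h₁ : r ≤ p₀) (h₂ : r ≤ q₀) (hr0 : 0 < r)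
    (hp : 0 < p) (hq : 0 < q) {R : Matrix (Fin p) (Fin p₀) ℝ} {C : Matrix (Fin q) (Fin q₀) ℝ}
    (hR : ((1 / Real.sqrt p) • R).transpose * ((1 / Real.sqrt p) • R) = 1)
    {Sig₁ : Matrix (Fin p₀) (Fin p₀) ℝ} {Sig₂ : Matrix (Fin q₀) (Fin q₀) ℝ}
    {Om₁ : Matrix (Fin p) (Fin p) ℝ} {Om₂ : Matrix (Fin q) (Fin q) ℝ} {c₁ C₁ c₂ C₂ : ℝ}
    (hc₁ : 0 < c₁) (hc₂ : 0 ≤ c₂) (hSig₁ : SpectrumIn Sig₁ c₁ C₁) (hSig₂ : SpectrumIn Sig₂ c₁ C₁)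
    (hOm₁ : SpectrumIn Om₁ c₂ C₂) {ρ : ℝ} (hρ : 0 < ρ) {z : LatentSpace p₀ q₀ p q} (hz : z ≠ 0)
    (hW : (leadingBlock h₁ h₂ (latentFactor z)).det ≠ 0) {B : Matrix (Fin q) (Fin q₀) ℝ} {d : ℝ}
    (hd : 0 < d) (hB : ∀ x, d * (x ⬝ᵥ x) ≤
      (((1 / (q : ℝ)) • (C.transpose * B)).mulVec x) ⬝ᵥ
        (((1 / (q : ℝ)) • (C.transpose * B)).mulVec x))
    {U : Matrix (Fin p) (Fin r) ℝ}
    (hU : IsLeadingEigenvectors (observation R C Sig₁ Sig₂ Om₁ Om₂ ρ z * loadingProj B *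
      (observation R C Sig₁ Sig₂ Om₁ Om₂ ρ z).transpose) U) :
    ∃ K : Matrix (Fin p₀) (Fin r) ℝ, K.transpose * K = 1 ∧
      K * K.transpose * (CFC.sqrt Sig₁ * latentFactor z) = CFC.sqrt Sig₁ * latentFactor z ∧
      ((1 - ((1 / Real.sqrt p) • R) * K * (((1 / Real.sqrt p) • R) * K).transpose) *
        (U * U.transpose)).trace ≤
        lossBound h₁ h₂ (4 * C₂ / (d * c₁ * c₁)) (CFC.sqrt Om₂) B z := by
  have hp' : (0 : ℝ) < p := by exact_mod_cast hp
  have hq' : (0 : ℝ) < q := by exact_mod_cast hq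
  have hz' : 0 < ‖z‖ := norm_pos_iff.mpr hz
  rw [observation_mul_loadingProj hp hq] at hU
  replace hU := hU.of_smul (by positivity)
  have hB₂ : ∀ x, d * c₁ * (x ⬝ᵥ x) ≤
      ((CFC.sqrt Sig₂ * ((1 / (q : ℝ)) • (C.transpose * B))).mulVec x) ⬝ᵥ
        ((CFC.sqrt Sig₂ * ((1 / (q : ℝ)) • (C.transpose * B))).mulVec x) := by
    intro x
    rw [← Matrix.mulVec_mulVec]
    refine le_trans ?_ (hSig₂.sqrt_bounds hc₁.le _).1
    nlinarith [hB x]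
  obtain ⟨K, hK, hKS, hKw⟩ := exists_factor_frame hr h₁ h₂ hr0 hW hc₁
    (fun x => (hSig₁.sqrt_bounds hc₁.le x).1) (mul_pos hd hc₁) hB₂
  refine ⟨K, hK, hKS, ?_⟩
  have hpos := frobSq_inv_pos hr0 hW
  have hKG : K * K.transpose * (CFC.sqrt Sig₁ * latentFactor z *
      (CFC.sqrt Sig₂ * ((1 / (q : ℝ)) • (C.transpose * B)))) = CFC.sqrt Sig₁ * latentFactor z *
      (CFC.sqrt Sig₂ * ((1 / (q : ℝ)) • (C.transpose * B))) := by
    rw [← Matrix.mul_assoc (K * K.transpose), hKS]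
  refine (trace_one_sub_le_min hR _ _ hU hK hKG
    (div_pos (mul_pos (mul_pos hd hc₁) hc₁) hpos) hKw).trans ?_
  refine mul_le_mul_of_nonneg_left (min_le_min le_rfl ?_) (Nat.cast_nonneg r)
  have h3 : frobSq ((1 / (q * Real.sqrt p)) •
      (CFC.sqrt Om₁ * latentNoise z * (CFC.sqrt Om₂ * B))) ≤
      C₂ * (noiseEnergy (CFC.sqrt Om₂) B z / ((q : ℝ) ^ 2 * p)) := by
    have h4 := frobSq_mul_le_of_mulVec_le (fun x => (hOm₁.sqrt_bounds hc₂ x).2)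
      (latentNoise z * (CFC.sqrt Om₂ * B))
    rw [frobSq_smul, div_pow, mul_pow, Real.sq_sqrt hp'.le, one_pow, Matrix.mul_assoc,
      noiseEnergy, mul_div_assoc', div_mul_eq_mul_div, one_mul]
    exact div_le_div_of_nonneg_right h4 (by positivity)
  rw [div_div_eq_mul_div]
  calc 4 * frobSq ((1 / (q * Real.sqrt p)) •
        (CFC.sqrt Om₁ * latentNoise z * (CFC.sqrt Om₂ * B))) *
        frobSq (leadingBlock h₁ h₂ (latentFactor z))⁻¹ / (d * c₁ * c₁)
      ≤ 4 * (C₂ * (noiseEnergy (CFC.sqrt Om₂) B z / ((q : ℝ) ^ 2 * p))) *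
        frobSq (leadingBlock h₁ h₂ (latentFactor z))⁻¹ / (d * c₁ * c₁) := by gcongr
    _ = _ := by ring

/-- One column of the factor matrix suffices. With y = Σ₁^{1/2}x and v_t the first column of Z_t^F,
the range of K_t contains Σ₁^{1/2}v_t, so (y·v_t)²/|v_t|² ≤ C|K_tᵀx|². The left sides average to at
least |y|²/(2p₀), and |y|² ≥ c|x|². -/
lemma frame_average_ge (hp₀ : 0 < p₀) (hq₀ : 0 < q₀) {Sig : Matrix (Fin p₀) (Fin p₀) ℝ} {c C : ℝ}
    (hc : 0 < c) (hC : 0 < C) (hSig : SpectrumIn Sig c C) {z : Fin T → LatentSpace p₀ q₀ p q}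
    {K : Fin T → Matrix (Fin p₀) (Fin r) ℝ} (hK : ∀ t, (K t).transpose * K t = 1)
    (hKS : ∀ t, K t * (K t).transpose * (CFC.sqrt Sig * latentFactor (z t)) =
      CFC.sqrt Sig * latentFactor (z t))
    (havg : ∀ i j, |(1 / (T : ℝ)) * ∑ t, columnProj hq₀ i j (z t) -
      (if i = j then 1 / (p₀ : ℝ) else 0)| ≤ 1 / (2 * (p₀ : ℝ) ^ 2)) (x : Fin p₀ → ℝ) :
    c / (2 * p₀ * C) * (x ⬝ᵥ x) ≤
      (1 / (T : ℝ)) * ∑ t, ((K t).transpose.mulVec x) ⬝ᵥ ((K t).transpose.mulVec x) := by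
  have hp' : (0 : ℝ) < p₀ := by exact_mod_cast hp₀
  set S := CFC.sqrt Sig with hS
  set y := S.mulVec x with hy
  set M : Matrix (Fin p₀) (Fin p₀) ℝ :=
    Matrix.of fun i j => (1 / (T : ℝ)) * ∑ t, columnProj hq₀ i j (z t) with hM
  have h1 := dotProduct_mulVec_ge_of_near_scalar hp₀ (M := M) havg y
  have h2 := (hSig.sqrt_bounds hc.le x).1
  rw [← hS, ← hy] at h2
  set v : Fin T → Fin p₀ → ℝ := fun t i => z t (Sum.inl (i, ⟨0, hq₀⟩)) with hv
  have hvv : ∀ t, ∑ k, z t (Sum.inl (k, ⟨0, hq₀⟩)) ^ 2 = v t ⬝ᵥ v t := by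
    intro t; simp [hv, dotProduct, sq]
  have h3 : y ⬝ᵥ M.mulVec y = (1 / (T : ℝ)) * ∑ t, (y ⬝ᵥ v t) ^ 2 / (v t ⬝ᵥ v t) := by
    have hMv : M = (1 / (T : ℝ)) • ∑ t, (v t ⬝ᵥ v t)⁻¹ • Matrix.vecMulVec (v t) (v t) := by
      ext i j
      simp only [hM, Matrix.of_apply, Matrix.smul_apply, Matrix.sum_apply, smul_eq_mul,
        Matrix.vecMulVec_apply, columnProj, hvv]
      exact congrArg _ (Finset.sum_congr rfl fun t _ => by rw [div_eq_inv_mul])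
    rw [hMv, Matrix.smul_mulVec, Matrix.sum_mulVec, dotProduct_smul, dotProduct_sum, smul_eq_mul]
    refine congrArg _ (Finset.sum_congr rfl fun t _ => ?_)
    rw [Matrix.smul_mulVec, Matrix.vecMulVec_mulVec, dotProduct_smul, dotProduct_smul]
    simp only [smul_eq_mul, op_smul_eq_smul, dotProduct_comm (v t) y]
    rw [div_eq_inv_mul, sq]
  have h4 : ∀ t, (y ⬝ᵥ v t) ^ 2 / (v t ⬝ᵥ v t) ≤
      C * (((K t).transpose.mulVec x) ⬝ᵥ ((K t).transpose.mulVec x)) := by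
    intro t
    have hKv : (K t * (K t).transpose).mulVec (S.mulVec (v t)) = S.mulVec (v t) := by
      have h5 : (latentFactor (z t)).mulVec (Pi.single ⟨0, hq₀⟩ 1) = v t := by
        ext i; simp [latentFactor, hv]
      rw [← h5, Matrix.mulVec_mulVec _ S, Matrix.mulVec_mulVec _ (K t * _), hKS]
    have h6 := dotProduct_sq_le_frame (hK t) (sqrt_transpose Sig)
      (fun x => (hSig.sqrt_bounds hc.le x).2) hKv x
    have h7 := dotProduct_self_nonneg' ((K t).transpose.mulVec x)
    -- This also covers v t = 0, where the quotient is 0.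
    refine div_le_of_le_mul₀ (dotProduct_self_nonneg' _) (by positivity) ?_
    calc (y ⬝ᵥ v t) ^ 2 ≤ _ := h6
      _ = _ := by ring
  have h5 : y ⬝ᵥ M.mulVec y ≤ C * ((1 / (T : ℝ)) *
      ∑ t, ((K t).transpose.mulVec x) ⬝ᵥ ((K t).transpose.mulVec x)) := by
    rw [h3, mul_left_comm, Finset.mul_sum _ _ C]
    exact mul_le_mul_of_nonneg_left (Finset.sum_le_sum fun t _ => h4 t) (by positivity)
  have h6 : c / (2 * p₀ * C) * (x ⬝ᵥ x) = (1 / (2 * (p₀ : ℝ)) * (c * (x ⬝ᵥ x))) / C := by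
    field_simp
  rw [h6, div_le_iff₀ hC, mul_comm _ C]
  exact (mul_le_mul_of_nonneg_left h2 (by positivity)).trans (h1.trans h5)

/-- All deterministic estimates together: with invertible blocks, column directions averaging close
to I/p₀ and a small mean loss, the subspace error is a constant times the mean loss. -/
lemma IsMPCAFUpdate.frobSq_defect_le (hp₀ : 0 < p₀) (hq₀ : 0 < q₀) (hT : 0 < T) (hp : 0 < p)
    (hq : 0 < q) {R : Matrix (Fin p) (Fin p₀) ℝ} {C : Matrix (Fin q) (Fin q₀) ℝ}
    (hR : ((1 / Real.sqrt p) • R).transpose * ((1 / Real.sqrt p) • R) = 1)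
    {Sig₁ : Matrix (Fin p₀) (Fin p₀) ℝ} {Sig₂ : Matrix (Fin q₀) (Fin q₀) ℝ}
    {Om₁ : Matrix (Fin p) (Fin p) ℝ} {Om₂ : Matrix (Fin q) (Fin q) ℝ} {c₁ C₁ c₂ C₂ : ℝ}
    (hc₁ : 0 < c₁) (hC₁ : 0 < C₁) (hc₂ : 0 ≤ c₂) (hSig₁ : SpectrumIn Sig₁ c₁ C₁)
    (hSig₂ : SpectrumIn Sig₂ c₁ C₁) (hOm₁ : SpectrumIn Om₁ c₂ C₂) {ρ : Fin T → ℝ}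
    (hρ : ∀ t, 0 < ρ t) {z : Fin T → LatentSpace p₀ q₀ p q} (hz : ∀ t, z t ≠ 0)
    (hW : ∀ t, (leadingBlock (min_le_left p₀ q₀) (min_le_right p₀ q₀)
      (latentFactor (z t))).det ≠ 0)
    {B : Matrix (Fin q) (Fin q₀) ℝ} {d : ℝ} (hd : 0 < d) (hB : ∀ x, d * (x ⬝ᵥ x) ≤
      (((1 / (q : ℝ)) • (C.transpose * B)).mulVec x) ⬝ᵥ
        (((1 / (q : ℝ)) • (C.transpose * B)).mulVec x))
    {Y : Matrix (Fin p) (Fin p₀) ℝ}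
    (hY : IsMPCAFUpdate (min p₀ q₀)
      (fun t => observation R C Sig₁ Sig₂ Om₁ Om₂ (ρ t) (z t)) B Y)
    {D : ℝ} (hD : (1 / (T : ℝ)) * ∑ t, lossBound (min_le_left p₀ q₀) (min_le_right p₀ q₀)
      (4 * C₂ / (d * c₁ * c₁)) (CFC.sqrt Om₂) B (z t) ≤ D)
    (hDlam : D ≤ c₁ / (2 * p₀ * C₁) / 8)
    (havg : ∀ i j, |(1 / (T : ℝ)) * ∑ t, columnProj hq₀ i j (z t) -
      (if i = j then 1 / (p₀ : ℝ) else 0)| ≤ 1 / (2 * (p₀ : ℝ) ^ 2)) :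
    p₀ - frobSq (((1 / Real.sqrt p) • R).transpose * ((1 / Real.sqrt p) • Y)) ≤
      4 / (c₁ / (2 * p₀ * C₁)) * D := by
  obtain ⟨U, hU, hUY⟩ := hY
  have hp' : (0 : ℝ) < p₀ := by exact_mod_cast hp₀
  choose K hK hKS hKloss using fun t => trace_one_sub_le_lossBound rfl (min_le_left p₀ q₀)
    (min_le_right p₀ q₀) (lt_min hp₀ hq₀) hp hq hR hc₁ hc₂ hSig₁ hSig₂ hOm₁ (hρ t) (hz t) (hW t)
    hd hB (hU t)
  refine frobSq_defect_le_average hT hR (fun t => (hU t).frame) hK (by positivity)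
    (le_trans ?_ hD) hDlam (frame_average_ge hp₀ hq₀ hc₁ hC₁ hSig₁ hK hKS havg) hUY
  exact mul_le_mul_of_nonneg_left (Finset.sum_le_sum fun t _ => hKloss t) (by positivity)

end Update

/-! ### Inverses of Gaussian matrices, one coordinate at a time. -/

section GaussianMatrix

/-- The density is at most 1/√(2π) ≤ 1; this is the anticoncentration used for the inverse entries.
-/
lemma gaussianReal_le_volume : gaussianReal 0 1 ≤ (volume : Measure ℝ) := by
  rw [gaussianReal_of_var_ne_zero _ one_ne_zero]
  calc volume.withDensity (gaussianPDF 0 1) ≤ volume.withDensity 1 := by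
        refine withDensity_mono (Eventually.of_forall fun x => ?_)
        rw [gaussianPDF, Pi.one_apply]
        refine ENNReal.ofReal_le_one.mpr ?_
        rw [gaussianPDFReal]
        have h1 : 1 ≤ Real.sqrt (2 * Real.pi * ((1 : NNReal) : ℝ)) := by
          rw [Real.one_le_sqrt]
          have := Real.pi_gt_three
          simp only [NNReal.coe_one, mul_one]
          linarith
        refine mul_le_one₀ (inv_le_one_of_one_le₀ h1) (Real.exp_pos _).le ?_
        rw [Real.exp_le_one_iff]
        exact div_nonpos_of_nonpos_of_nonneg (by simp [sq_nonneg]) (by simp)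
    _ = volume := withDensity_one

/-- With u = (x + b)/τ, min(1, u⁻²) ≤ 2/(1 + u²), whose Lebesgue integral in x is 2πτ ≤ 7τ whatever
the shift b. -/
lemma lintegral_min_one_div_sq_le {τ : ℝ} (hτ : 0 < τ) (b : ℝ) :
    ∫⁻ x, ENNReal.ofReal (min 1 (τ ^ 2 * (1 / (x + b)) ^ 2)) ∂(gaussianReal 0 1) ≤
      ENNReal.ofReal (7 * τ) := by
  have hint : Integrable (fun x : ℝ => 2 * (1 + ((x + b) / τ) ^ 2)⁻¹) :=
    ((integrable_inv_one_add_sq.comp_div hτ.ne').comp_add_right b).const_mul 2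
  calc ∫⁻ x, ENNReal.ofReal (min 1 (τ ^ 2 * (1 / (x + b)) ^ 2)) ∂(gaussianReal 0 1)
      ≤ ∫⁻ x, ENNReal.ofReal (min 1 (τ ^ 2 * (1 / (x + b)) ^ 2)) :=
        lintegral_mono' gaussianReal_le_volume le_rfl
    _ ≤ ∫⁻ x, ENNReal.ofReal (2 * (1 + ((x + b) / τ) ^ 2)⁻¹) := by
        refine lintegral_mono fun x => ENNReal.ofReal_le_ofReal ?_
        set u := (x + b) / τ with hu
        have h1 : τ ^ 2 * (1 / (x + b)) ^ 2 = (u ^ 2)⁻¹ := by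
          rw [hu, ← inv_pow, inv_div]
          ring
        have h2 : 0 < 1 + u ^ 2 := by positivity
        rw [h1, ← div_eq_mul_inv, le_div_iff₀ h2]
        rcases le_total (u ^ 2) 1 with h | h
        · nlinarith [min_le_left 1 (u ^ 2)⁻¹]
        · have h3 : (u ^ 2)⁻¹ * u ^ 2 = 1 := inv_mul_cancel₀ (by positivity)
          nlinarith [min_le_left 1 (u ^ 2)⁻¹, min_le_right 1 (u ^ 2)⁻¹]
    _ = ENNReal.ofReal (∫ x, 2 * (1 + ((x + b) / τ) ^ 2)⁻¹) :=
        (ofReal_integral_eq_lintegral_ofReal hint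
          (Eventually.of_forall fun x => by positivity)).symm
    _ ≤ ENNReal.ofReal (7 * τ) := by
        refine ENNReal.ofReal_le_ofReal ?_
        rw [integral_const_mul, integral_add_right_eq_self (fun x : ℝ => (1 + (x / τ) ^ 2)⁻¹) b,
          Measure.integral_comp_div (fun x : ℝ => (1 + x ^ 2)⁻¹), integral_univ_inv_one_add_sq,
          abs_of_pos hτ, smul_eq_mul]
        nlinarith [Real.pi_lt_d2]

/-- The determinant is affine in a single entry, with the cofactor as slope. -/
lemma det_updateRow_update {r : ℕ} (W : Matrix (Fin r) (Fin r) ℝ) (i j : Fin r) (x : ℝ) :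
    (W.updateRow i (Function.update (W i) j x)).det =
      x * W.adjugate j i + (W.updateRow i (Function.update (W i) j 0)).det := by
  have h : Function.update (W i) j x = x • Pi.single j 1 + Function.update (W i) j 0 := by
    ext k
    by_cases hk : k = j
    · subst hk; simp
    · simp [hk]
  rw [h, Matrix.det_updateRow_add, Matrix.det_updateRow_smul, Matrix.adjugate_apply]

lemma adjugate_updateRow {r : ℕ} (W : Matrix (Fin r) (Fin r) ℝ) (i j : Fin r) (v : Fin r → ℝ) :
    (W.updateRow i v).adjugate j i = W.adjugate j i := by
  rw [Matrix.adjugate_apply, Matrix.adjugate_apply, Matrix.updateRow_idem]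

variable {ι : Type*}

/-- The square matrix formed from selected coordinates. -/
def coordMatrix {r : ℕ} (e : Fin r → Fin r → ι) (z : ι → ℝ) : Matrix (Fin r) (Fin r) ℝ :=
  Matrix.of fun i j => z (e i j)

lemma coordMatrix_update [DecidableEq ι] {r : ℕ} {e : Fin r → Fin r → ι}
    (he : ∀ i j i' j', e i j = e i' j' → i = i' ∧ j = j') (z : ι → ℝ) (i j : Fin r) (x : ℝ) :
    coordMatrix e (Function.update z (e i j) x) =
      (coordMatrix e z).updateRow i (Function.update (coordMatrix e z i) j x) := by
  ext k l
  simp only [coordMatrix, Matrix.of_apply, Matrix.updateRow_apply, Function.update_apply]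
  by_cases hk : k = i
  · subst hk
    by_cases hl : l = j
    · subst hl; simp
    · have : e k l ≠ e k j := fun h => hl (he _ _ _ _ h).2
      simp [hl, this]
  · have : e k l ≠ e i j := fun h => hk (he _ _ _ _ h).1
    simp [hk, this]

lemma measurable_coordMatrix_det {r : ℕ} (e : Fin r → Fin r → ι) :
    Measurable fun z : ι → ℝ => (coordMatrix e z).det := by
  simp only [Matrix.det_apply, coordMatrix, Matrix.of_apply]
  fun_prop

lemma measurable_coordMatrix_adjugate {r : ℕ} (e : Fin r → Fin r → ι) (i j : Fin r) :
    Measurable fun z : ι → ℝ => (coordMatrix e z).adjugate i j := by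
  simp only [Matrix.adjugate_apply, Matrix.det_apply, coordMatrix, Matrix.updateRow_apply,
    Matrix.of_apply]
  refine Finset.measurable_sum _ fun σ _ => Measurable.const_smul ?_ _
  refine Finset.measurable_prod _ fun k _ => ?_
  split_ifs <;> fun_prop

variable [Fintype ι]

/-- A square matrix of independent Gaussian entries is almost surely invertible. -/
lemma ae_coordMatrix_det_ne_zero {r : ℕ} {e : Fin r → Fin r → ι}
    (he : ∀ i j i' j', e i j = e i' j' → i = i' ∧ j = j') :
    ∀ᵐ z ∂(Measure.pi fun _ : ι => gaussianReal 0 1), (coordMatrix e z).det ≠ 0 := by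
  classical
  induction r with
  | zero => simp
  | succ r ih =>
    have ih' := ih (e := fun i j => e i.succ j.succ) fun i j i' j' h => by
      simpa using he _ _ _ _ h
    have hadj : ∀ z : ι → ℝ, (coordMatrix e z).adjugate 0 0 =
        (coordMatrix (fun i j => e i.succ j.succ) z).det := by
      intro z
      rw [Matrix.adjugate_fin_succ_eq_det_submatrix]
      simp only [Fin.val_zero, add_zero, pow_zero, one_mul, Fin.succAbove_zero]
      rfl
    -- The cofactor at (0, 0) is a smaller determinant, nonzero almost surely by induction. Given
    -- that, the determinant is a nonconstant affine function of the coordinate `e 0 0` and vanishes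
    -- at one value only, a Gaussian null set.
    set s : Set (ι → ℝ) := {z | (coordMatrix e z).det = 0 ∧ (coordMatrix e z).adjugate 0 0 ≠ 0}
    have hs : MeasurableSet s :=
      (measurable_coordMatrix_det e (measurableSet_singleton 0)).inter
        (measurable_coordMatrix_adjugate e 0 0 (measurableSet_singleton 0).compl)
    have hs0 : (Measure.pi fun _ : ι => gaussianReal 0 1) s = 0 := by
      rw [← lintegral_indicator_one hs, ← nonpos_iff_eq_zero]
      refine (lintegral_le_of_lmarginal_le {e 0 0} (measurable_one.indicator hs)
        (g := fun _ => 0) measurable_const ?_).trans_eq (by simp)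
      intro z
      rw [lmarginal_singleton, lmarginal_singleton, lintegral_zero, nonpos_iff_eq_zero]
      refine lintegral_eq_zero_of_ae_eq_zero ?_
      set a := (coordMatrix e z).adjugate 0 0
      set β := ((coordMatrix e z).updateRow 0 (Function.update (coordMatrix e z 0) 0 0)).det
      have hx : ∀ᵐ x ∂(gaussianReal 0 1), x ≠ -β / a :=
        compl_mem_ae_iff.mpr (gaussianReal_absolutelyContinuous 0 one_ne_zero
          (measure_singleton _))
      filter_upwards [hx] with x hx
      refine Set.indicator_of_notMem (fun hmem => ?_) _
      obtain ⟨h1, h2⟩ := hmem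
      rw [coordMatrix_update he, det_updateRow_update] at h1
      rw [coordMatrix_update he, adjugate_updateRow] at h2
      exact hx (by rw [eq_div_iff h2]; linarith)
    filter_upwards [ih', compl_mem_ae_iff.mpr hs0] with z h1 h2 h3
    exact h2 ⟨h3, by rwa [hadj]⟩

/-- Freeze all coordinates but x = z (e i j). The cofactor a does not involve x and the determinant
is ax + β, so the inverse entry at the transposed position (j, i) is 1/(x + β/a). The weight g is
constant in x and factors out. -/
lemma lintegral_min_one_inv_entry_le {r : ℕ} {e : Fin r → Fin r → ι}
    (he : ∀ i j i' j', e i j = e i' j' → i = i' ∧ j = j') [DecidableEq ι] (i j : Fin r) {τ : ℝ}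
    (hτ : 0 < τ) {g : (ι → ℝ) → ENNReal} (hg : Measurable g)
    (hgi : ∀ z x, g (Function.update z (e i j) x) = g z) :
    ∫⁻ z, ENNReal.ofReal (min 1 (τ ^ 2 * ((coordMatrix e z)⁻¹ j i) ^ 2)) * g z
        ∂(Measure.pi fun _ : ι => gaussianReal 0 1) ≤
      ENNReal.ofReal (7 * τ) * ∫⁻ z, g z ∂(Measure.pi fun _ : ι => gaussianReal 0 1) := by
  have hinv : ∀ W : Matrix (Fin r) (Fin r) ℝ, W⁻¹ j i = W.adjugate j i / W.det := by
    intro W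
    rw [Matrix.inv_def, Ring.inverse_eq_inv', Matrix.smul_apply, smul_eq_mul, div_eq_inv_mul]
  have hmeas : Measurable fun z : ι → ℝ =>
      ENNReal.ofReal (min 1 (τ ^ 2 * ((coordMatrix e z)⁻¹ j i) ^ 2)) := by
    simp only [hinv]
    have h1 := measurable_coordMatrix_det e
    have h2 := measurable_coordMatrix_adjugate e j i
    fun_prop
  rw [← lintegral_const_mul _ hg]
  refine lintegral_le_of_lmarginal_le {e i j} (hmeas.mul hg) (hg.const_mul _) fun z => ?_
  rw [lmarginal_singleton, lmarginal_singleton]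
  simp only [hgi]
  rw [lintegral_mul_const _ (by have := hmeas.comp (measurable_update z (a := e i j)); exact this),
    lintegral_const, measure_univ, mul_one]
  refine mul_le_mul_left ?_ _
  simp only [hinv, coordMatrix_update he, adjugate_updateRow]
  set a := (coordMatrix e z).adjugate j i
  set β := ((coordMatrix e z).updateRow i (Function.update (coordMatrix e z i) j 0)).det
  -- A vanishing cofactor makes the inverse entry 0, so the integrand vanishes.
  by_cases ha : a = 0
  · simp [ha]
  · refine le_trans (le_of_eq (lintegral_congr fun x => ?_))
      (lintegral_min_one_div_sq_le hτ (β / a))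
    congr 4
    rw [det_updateRow_update, show x + β / a = (x * a + β) / a by field_simp, one_div_div]

end GaussianMatrix

/-! ### Expected loss of a single observation. -/

section LatentIntegrals

variable {p₀ q₀ r p q T : ℕ}

lemma lintegral_inner_sq_stdGaussian {ι : Type*} [Fintype ι] (v : EuclideanSpace ℝ ι) :
    ∫⁻ z, ENNReal.ofReal ((inner ℝ v z) ^ 2) ∂(stdGaussian (EuclideanSpace ℝ ι)) =
      ENNReal.ofReal (‖v‖ ^ 2) := by
  set L : StrongDual ℝ (EuclideanSpace ℝ ι) := innerSL ℝ v with hL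
  have h1 := variance_dual_stdGaussian L
  have h2 := integral_strongDual_stdGaussian L
  rw [variance_of_integral_eq_zero L.continuous.measurable.aemeasurable h2] at h1
  have h3 : ‖L‖ = ‖v‖ := innerSL_apply_norm ℝ v
  rw [h3] at h1
  have hL2 : MemLp L 2 (stdGaussian (EuclideanSpace ℝ ι)) :=
    IsGaussian.memLp_dual _ L 2 (by simp)
  rw [← h1, ofReal_integral_eq_lintegral_ofReal hL2.integrable_sq
    (Eventually.of_forall fun _ => sq_nonneg _)]
  rfl

lemma ofReal_frobSq {m k : ℕ} (A : Matrix (Fin m) (Fin k) ℝ) :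
    ENNReal.ofReal (frobSq A) = ∑ i, ∑ j, ENNReal.ofReal (A i j ^ 2) := by
  refine (ENNReal.ofReal_sum_of_nonneg fun i _ =>
    Finset.sum_nonneg fun j _ => sq_nonneg (A i j)).trans ?_
  exact Finset.sum_congr rfl fun i _ => ENNReal.ofReal_sum_of_nonneg fun _ _ => sq_nonneg _

lemma lintegral_stdGaussian_eq_pi {ι : Type*} [Fintype ι] (f : EuclideanSpace ℝ ι → ENNReal) :
    ∫⁻ z, f z ∂(stdGaussian (EuclideanSpace ℝ ι)) =
      ∫⁻ x, f (WithLp.toLp 2 x) ∂(Measure.pi fun _ : ι => gaussianReal 0 1) := by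
  rw [← map_pi_eq_stdGaussian]
  exact lintegral_map_equiv f (MeasurableEquiv.toLp 2 _)

lemma measurable_inv_coordMatrix {ι : Type*} {r : ℕ} (e : Fin r → Fin r → ι) (i j : Fin r) :
    Measurable fun z : EuclideanSpace ℝ ι => (coordMatrix e z.ofLp)⁻¹ i j := by
  have hm : Measurable fun z : EuclideanSpace ℝ ι => z.ofLp := WithLp.measurable_ofLp 2 _
  simp only [Matrix.inv_def, Ring.inverse_eq_inv', Matrix.smul_apply, smul_eq_mul]
  exact (((measurable_coordMatrix_det _).comp hm).inv).mul
    ((measurable_coordMatrix_adjugate _ i j).comp hm)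

lemma lintegral_frobSq_latentNoise_mul {k : ℕ} (D : Matrix (Fin q) (Fin k) ℝ) :
    ∫⁻ z, ENNReal.ofReal (frobSq (latentNoise z * D)) ∂(stdGaussian (LatentSpace p₀ q₀ p q)) =
      ENNReal.ofReal (p * frobSq D) := by
  -- Each entry of the projected noise is a linear form ⟨v i j, z⟩, hence has second moment ‖v i
  -- j‖².
  let v : Fin p → Fin k → LatentSpace p₀ q₀ p q := fun i j =>
    WithLp.toLp 2 (Sum.elim 0 fun x => if x.1 = i then D x.2 j else 0)
  have hinner : ∀ i j (z : LatentSpace p₀ q₀ p q), inner ℝ (v i j) z = (latentNoise z * D) i j := by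
    intro i j z
    rw [EuclideanSpace.inner_eq_star_dotProduct]
    simp [v, dotProduct, Fintype.sum_sum_type, Fintype.sum_prod_type, latentNoise,
      Matrix.mul_apply]
  have hnorm : ∀ i j, ‖v i j‖ ^ 2 = ∑ l, D l j ^ 2 := by
    intro i j
    rw [EuclideanSpace.norm_sq_eq]
    simp [v, Fintype.sum_sum_type, Fintype.sum_prod_type, ite_pow]
  have h1 : ∀ z : LatentSpace p₀ q₀ p q, ENNReal.ofReal (frobSq (latentNoise z * D)) =
      ∑ i, ∑ j, ENNReal.ofReal ((inner ℝ (v i j) z) ^ 2) := by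
    intro z
    simp only [hinner]
    exact ofReal_frobSq _
  have hmeas : ∀ i j, Measurable fun z : LatentSpace p₀ q₀ p q =>
      ENNReal.ofReal ((inner ℝ (v i j) z) ^ 2) := fun i j => by fun_prop
  simp only [h1]
  rw [lintegral_finsetSum _ fun i _ => Finset.measurable_sum _ fun j _ => hmeas i j]
  simp only [lintegral_finsetSum _ fun j _ => hmeas _ j, lintegral_inner_sq_stdGaussian, hnorm]
  rw [Finset.sum_const, Finset.card_univ, Fintype.card_fin,
    ← ENNReal.ofReal_sum_of_nonneg fun _ _ => Finset.sum_nonneg fun _ _ => sq_nonneg _,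
    frobSq, Finset.sum_comm, ENNReal.ofReal_mul (Nat.cast_nonneg p), ENNReal.ofReal_natCast,
    nsmul_eq_mul]

/-- The coordinates of the leading block of the factor matrix. -/
def blockCoord (p q : ℕ) (h₁ : r ≤ p₀) (h₂ : r ≤ q₀) (i j : Fin r) :
    (Fin p₀ × Fin q₀) ⊕ (Fin p × Fin q) :=
  Sum.inl (Fin.castLE h₁ i, Fin.castLE h₂ j)

lemma blockCoord_injective (h₁ : r ≤ p₀) (h₂ : r ≤ q₀) (i j i' j' : Fin r)
    (h : blockCoord p q h₁ h₂ i j = blockCoord p q h₁ h₂ i' j') : i = i' ∧ j = j' := by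
  simpa [blockCoord] using h

lemma leadingBlock_latentFactor (h₁ : r ≤ p₀) (h₂ : r ≤ q₀) (z : LatentSpace p₀ q₀ p q) :
    leadingBlock h₁ h₂ (latentFactor z) = coordMatrix (blockCoord p q h₁ h₂) z.ofLp := rfl

lemma ae_leadingBlock_det_ne_zero (h₁ : r ≤ p₀) (h₂ : r ≤ q₀) :
    ∀ᵐ z ∂(stdGaussian (LatentSpace p₀ q₀ p q)),
      (leadingBlock h₁ h₂ (latentFactor z)).det ≠ 0 := by
  rw [← map_pi_eq_stdGaussian]
  have hm : Measurable fun z : LatentSpace p₀ q₀ p q =>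
      (leadingBlock h₁ h₂ (latentFactor z)).det := by
    simp only [leadingBlock_latentFactor]
    exact (measurable_coordMatrix_det _).comp (WithLp.measurable_ofLp 2 _)
  refine (ae_map_iff (WithLp.measurable_toLp 2 _).aemeasurable
    (hm (measurableSet_singleton 0).compl)).mpr ?_
  exact ae_coordMatrix_det_ne_zero (blockCoord_injective h₁ h₂)

/-- Replaces the random coefficient a by a fixed scale s at the cost of a factor linear in a, so
that noise and factor matrix decouple and a first moment of the noise suffices. -/
lemma min_one_mul_le {a u s : ℝ} (ha : 0 ≤ a) (hu : 0 ≤ u) (hs : 0 < s) :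
    min 1 (a * u) ≤ min 1 (s * u) * (1 + a / s) := by
  have h1 : 0 ≤ a / s := by positivity
  rcases le_total 1 (s * u) with h | h
  · rw [min_eq_left h]
    linarith [min_le_left 1 (a * u)]
  · rw [min_eq_right h]
    refine (min_le_right _ _).trans ?_
    have h2 : s * u * (a / s) = a * u := by field_simp
    nlinarith [mul_nonneg hs.le hu]

lemma min_one_sum_le {α : Type*} (s : Finset α) {f : α → ℝ} (hf : ∀ i, 0 ≤ f i) :
    min 1 (∑ i ∈ s, f i) ≤ ∑ i ∈ s, min 1 (f i) := by
  classical
  induction s using Finset.induction_on with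
  | empty => simp
  | insert i s hi ih =>
    rw [Finset.sum_insert hi, Finset.sum_insert hi]
    have h1 := hf i
    have h2 : 0 ≤ ∑ i ∈ s, f i := Finset.sum_nonneg fun i _ => hf i
    refine le_trans ?_ (add_le_add_right ih _)
    simp only [min_def]
    split_ifs <;> linarith

lemma noiseEnergy_nonneg (S : Matrix (Fin q) (Fin q) ℝ) (B : Matrix (Fin q) (Fin q₀) ℝ)
    (z : LatentSpace p₀ q₀ p q) : 0 ≤ noiseEnergy S B z := frobSq_nonneg _

lemma lossBound_nonneg (h₁ : r ≤ p₀) (h₂ : r ≤ q₀) {κ : ℝ} (hκ : 0 ≤ κ)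
    (S : Matrix (Fin q) (Fin q) ℝ) (B : Matrix (Fin q) (Fin q₀) ℝ) (z : LatentSpace p₀ q₀ p q) :
    0 ≤ lossBound h₁ h₂ κ S B z := by
  have := noiseEnergy_nonneg S B z
  have := frobSq_nonneg (leadingBlock h₁ h₂ (latentFactor z))⁻¹
  unfold lossBound
  positivity

lemma measurable_frobSq_inv_leadingBlock (h₁ : r ≤ p₀) (h₂ : r ≤ q₀) :
    Measurable fun z : LatentSpace p₀ q₀ p q =>
      frobSq (leadingBlock h₁ h₂ (latentFactor z))⁻¹ := by
  simp only [leadingBlock_latentFactor, frobSq]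
  exact Finset.measurable_sum _ fun i _ => Finset.measurable_sum _ fun j _ =>
    (measurable_inv_coordMatrix _ i j).pow_const 2

lemma measurable_lossBound (h₁ : r ≤ p₀) (h₂ : r ≤ q₀) (κ : ℝ) (S : Matrix (Fin q) (Fin q) ℝ) :
    Measurable fun x : (Fin q → Fin q₀ → ℝ) × LatentSpace p₀ q₀ p q =>
      lossBound h₁ h₂ κ S (Matrix.of x.1) x.2 := by
  have h1 : Measurable fun x : (Fin q → Fin q₀ → ℝ) × LatentSpace p₀ q₀ p q =>
      noiseEnergy S (Matrix.of x.1) x.2 := by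
    simp only [noiseEnergy, frobSq, Matrix.mul_apply, latentNoise, Matrix.of_apply]
    fun_prop
  have h2 : Measurable fun x : (Fin q → Fin q₀ → ℝ) × LatentSpace p₀ q₀ p q =>
      frobSq (leadingBlock h₁ h₂ (latentFactor x.2))⁻¹ :=
    (measurable_frobSq_inv_leadingBlock h₁ h₂).comp measurable_snd
  exact (measurable_const.min (((h1.div_const _).const_mul κ).mul h2)).const_mul _

/-- Truncation at 1 is subadditive over nonnegative terms, so ‖W⁻¹‖² splits into entries, each of
which can be integrated along its own coordinate. -/
lemma lossBound_le_sum (h₁ : r ≤ p₀) (h₂ : r ≤ q₀) {κ : ℝ} (hκ : 0 ≤ κ)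
    (S : Matrix (Fin q) (Fin q) ℝ) (B : Matrix (Fin q) (Fin q₀) ℝ) (z : LatentSpace p₀ q₀ p q)
    {s : ℝ} (hs : 0 < s) :
    lossBound h₁ h₂ κ S B z ≤ ∑ i, ∑ j,
      min 1 (s * ((coordMatrix (blockCoord p q h₁ h₂) z.ofLp)⁻¹ j i) ^ 2) *
        (r * (1 + κ * (noiseEnergy S B z / ((q : ℝ) ^ 2 * p)) / s)) := by
  rw [lossBound, leadingBlock_latentFactor, ← frobSq_transpose]
  set W := coordMatrix (blockCoord p q h₁ h₂) z.ofLp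
  set a := κ * (noiseEnergy S B z / ((q : ℝ) ^ 2 * p)) with ha
  have ha0 : 0 ≤ a := by
    have := noiseEnergy_nonneg S B z
    positivity
  simp only [frobSq, Matrix.transpose_apply, Finset.mul_sum]
  have h5 := min_one_sum_le Finset.univ (f := fun i => ∑ j, a * (W⁻¹ j i) ^ 2)
    fun i => Finset.sum_nonneg fun j _ => mul_nonneg ha0 (sq_nonneg _)
  refine (mul_le_mul_of_nonneg_left h5 (Nat.cast_nonneg r)).trans ?_
  rw [Finset.mul_sum]
  refine Finset.sum_le_sum fun i _ => ?_
  have h6 := min_one_sum_le Finset.univ (f := fun j => a * (W⁻¹ j i) ^ 2)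
    fun j => mul_nonneg ha0 (sq_nonneg _)
  refine (mul_le_mul_of_nonneg_left h6 (Nat.cast_nonneg r)).trans ?_
  rw [Finset.mul_sum]
  refine Finset.sum_le_sum fun j _ => ?_
  have h7 := min_one_mul_le ha0 (sq_nonneg (W⁻¹ j i)) hs
  calc (r : ℝ) * min 1 (a * (W⁻¹ j i) ^ 2)
      ≤ r * (min 1 (s * (W⁻¹ j i) ^ 2) * (1 + a / s)) :=
        mul_le_mul_of_nonneg_left h7 (Nat.cast_nonneg r)
    _ = _ := by ring

lemma ofReal_lossBound_le_sum (h₁ : r ≤ p₀) (h₂ : r ≤ q₀) {κ : ℝ} (hκ : 0 ≤ κ)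
    (S : Matrix (Fin q) (Fin q) ℝ) (B : Matrix (Fin q) (Fin q₀) ℝ) (z : LatentSpace p₀ q₀ p q)
    {s : ℝ} (hs : 0 < s) :
    ENNReal.ofReal (lossBound h₁ h₂ κ S B z) ≤ ∑ i, ∑ j, ENNReal.ofReal
      (min 1 (s * ((coordMatrix (blockCoord p q h₁ h₂) z.ofLp)⁻¹ j i) ^ 2)) *
        ENNReal.ofReal (r * (1 + κ * (noiseEnergy S B z / ((q : ℝ) ^ 2 * p)) / s)) := by
  refine (ENNReal.ofReal_le_ofReal (lossBound_le_sum h₁ h₂ hκ S B z hs)).trans_eq ?_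
  have hg0 : 0 ≤ (r : ℝ) * (1 + κ * (noiseEnergy S B z / ((q : ℝ) ^ 2 * p)) / s) := by
    have := noiseEnergy_nonneg S B z
    positivity
  set W := coordMatrix (blockCoord p q h₁ h₂) z.ofLp
  have hm0 : ∀ i j, 0 ≤ min 1 (s * (W⁻¹ j i) ^ 2) := fun i j => by positivity
  rw [ENNReal.ofReal_sum_of_nonneg fun i _ => Finset.sum_nonneg fun j _ =>
    mul_nonneg (hm0 i j) hg0]
  refine Finset.sum_congr rfl fun i _ => ?_
  rw [ENNReal.ofReal_sum_of_nonneg fun j _ => mul_nonneg (hm0 i j) hg0]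
  exact Finset.sum_congr rfl fun j _ => ENNReal.ofReal_mul (hm0 i j)

/-- The mean noise energy is p‖SB‖² ≤ pCq, so the coefficient has mean at most κC/q, matching the
scale s = 1/q. -/
lemma lintegral_noiseFactor_le (hp : 0 < p) (hq : 0 < q) {κ : ℝ} (hκ : 0 ≤ κ)
    (S : Matrix (Fin q) (Fin q) ℝ) (B : Matrix (Fin q) (Fin q₀) ℝ) {C : ℝ}
    (hSB : frobSq (S * B) ≤ C * q) :
    ∫⁻ z, ENNReal.ofReal (r * (1 + κ * (noiseEnergy S B z / ((q : ℝ) ^ 2 * p)) / (q : ℝ)⁻¹))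
        ∂(stdGaussian (LatentSpace p₀ q₀ p q)) ≤ ENNReal.ofReal (r * (1 + κ * C)) := by
  have hp' : (0 : ℝ) < p := by exact_mod_cast hp
  have hq' : (0 : ℝ) < q := by exact_mod_cast hq
  have hsplit : ∀ z : LatentSpace p₀ q₀ p q,
      ENNReal.ofReal (r * (1 + κ * (noiseEnergy S B z / ((q : ℝ) ^ 2 * p)) / (q : ℝ)⁻¹)) =
      ENNReal.ofReal r +
      ENNReal.ofReal (r * κ / (q * p)) * ENNReal.ofReal (frobSq (latentNoise z * (S * B))) := by
    intro z
    rw [← ENNReal.ofReal_mul (by positivity), ← ENNReal.ofReal_add (Nat.cast_nonneg r)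
      (mul_nonneg (by positivity) (frobSq_nonneg _))]
    rw [noiseEnergy]
    congr 1
    field_simp
  simp only [hsplit]
  rw [lintegral_add_left measurable_const, lintegral_const, measure_univ, mul_one,
    lintegral_const_mul' _ _ ENNReal.ofReal_ne_top, lintegral_frobSq_latentNoise_mul,
    ← ENNReal.ofReal_mul (by positivity), ← ENNReal.ofReal_add (Nat.cast_nonneg r)
      (mul_nonneg (by positivity) (mul_nonneg hp'.le (frobSq_nonneg _)))]
  refine ENNReal.ofReal_le_ofReal ?_
  have h8 : r * κ / (q * p) * (p * frobSq (S * B)) ≤ r * κ / (q * p) * (p * (C * q)) := by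
    gcongr
  refine (add_le_add_right h8 _).trans_eq ?_
  field_simp

lemma measurable_noiseEnergy (S : Matrix (Fin q) (Fin q) ℝ) (B : Matrix (Fin q) (Fin q₀) ℝ) :
    Measurable fun z : LatentSpace p₀ q₀ p q => noiseEnergy S B z := by
  simp only [noiseEnergy, frobSq, Matrix.mul_apply, latentNoise, Matrix.of_apply]
  fun_prop

lemma lintegral_inv_entry_mul_noise_le (h₁ : r ≤ p₀) (h₂ : r ≤ q₀) (i j : Fin r) {τ : ℝ}
    (hτ : 0 < τ) (S : Matrix (Fin q) (Fin q) ℝ) (B : Matrix (Fin q) (Fin q₀) ℝ) {g : ℝ → ENNReal}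
    (hg : Measurable g) :
    ∫⁻ z : LatentSpace p₀ q₀ p q, ENNReal.ofReal
        (min 1 (τ ^ 2 * ((coordMatrix (blockCoord p q h₁ h₂) z.ofLp)⁻¹ j i) ^ 2)) *
        g (noiseEnergy S B z) ∂(stdGaussian (LatentSpace p₀ q₀ p q)) ≤
      ENNReal.ofReal (7 * τ) *
        ∫⁻ z, g (noiseEnergy S B z) ∂(stdGaussian (LatentSpace p₀ q₀ p q)) := by
  rw [lintegral_stdGaussian_eq_pi, lintegral_stdGaussian_eq_pi]
  refine lintegral_min_one_inv_entry_le (blockCoord_injective h₁ h₂) i j hτ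
    ((hg.comp (measurable_noiseEnergy S B)).comp (WithLp.measurable_toLp 2 _)) fun z x => ?_
  have : (latentNoise (WithLp.toLp 2 (Function.update z (blockCoord p q h₁ h₂ i j) x)) :
      Matrix (Fin p) (Fin q) ℝ) = latentNoise (WithLp.toLp 2 z) := by
    ext k l
    simp [latentNoise, blockCoord]
  simp only [noiseEnergy, this]

/-- Source of the rate: with τ² = 1/q, each of the r² entries contributes 7τ from the inverse and
r(1 + κC) from the noise, which is independent of the factor block. -/
lemma lintegral_lossBound_le (h₁ : r ≤ p₀) (h₂ : r ≤ q₀) (hp : 0 < p) (hq : 0 < q) {κ : ℝ}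
    (hκ : 0 ≤ κ) (S : Matrix (Fin q) (Fin q) ℝ) (B : Matrix (Fin q) (Fin q₀) ℝ) {C : ℝ}
    (hSB : frobSq (S * B) ≤ C * q) :
    ∫⁻ z, ENNReal.ofReal (lossBound h₁ h₂ κ S B z) ∂(stdGaussian (LatentSpace p₀ q₀ p q)) ≤
      ENNReal.ofReal (7 * (r : ℝ) ^ 3 * (1 + κ * C) * (q : ℝ) ^ (-1 / 2 : ℝ)) := by
  have hq' : (0 : ℝ) < q := by exact_mod_cast hq
  set τ : ℝ := (q : ℝ) ^ (-1 / 2 : ℝ) with hτdef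
  have hτ : 0 < τ := Real.rpow_pos_of_pos hq' _
  have hτ2 : τ ^ 2 = (q : ℝ)⁻¹ := by
    rw [hτdef, ← Real.rpow_natCast, ← Real.rpow_mul hq'.le, ← Real.rpow_neg_one]
    norm_num
  set g : ℝ → ENNReal := fun x =>
    ENNReal.ofReal (r * (1 + κ * (x / ((q : ℝ) ^ 2 * p)) / (q : ℝ)⁻¹)) with hg
  have hgM : Measurable g := by
    simp only [hg]; fun_prop
  have hM : ∀ i j : Fin r, Measurable fun z : LatentSpace p₀ q₀ p q => ENNReal.ofReal
      (min 1 (τ ^ 2 * ((coordMatrix (blockCoord p q h₁ h₂) z.ofLp)⁻¹ j i) ^ 2)) *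
        g (noiseEnergy S B z) := fun i j =>
    ((measurable_const.min (((measurable_inv_coordMatrix _ j i).pow_const 2).const_mul
      _)).ennreal_ofReal).mul (hgM.comp (measurable_noiseEnergy S B))
  calc ∫⁻ z, ENNReal.ofReal (lossBound h₁ h₂ κ S B z) ∂(stdGaussian (LatentSpace p₀ q₀ p q))
      ≤ ∫⁻ z : LatentSpace p₀ q₀ p q, ∑ i, ∑ j, ENNReal.ofReal
          (min 1 (τ ^ 2 * ((coordMatrix (blockCoord p q h₁ h₂) z.ofLp)⁻¹ j i) ^ 2)) *
            g (noiseEnergy S B z) ∂(stdGaussian (LatentSpace p₀ q₀ p q)) := by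
        refine lintegral_mono fun z => ?_
        simp only [hg, hτ2]
        exact ofReal_lossBound_le_sum h₁ h₂ hκ S B z (inv_pos.mpr hq')
    _ ≤ ∑ i : Fin r, ∑ j : Fin r, ENNReal.ofReal (7 * τ) * ENNReal.ofReal (r * (1 + κ * C)) := by
        rw [lintegral_finsetSum _ fun i _ => Finset.measurable_sum _ fun j _ => hM i j]
        refine Finset.sum_le_sum fun i _ => ?_
        rw [lintegral_finsetSum _ fun j _ => hM i j]
        exact Finset.sum_le_sum fun j _ =>
          (lintegral_inv_entry_mul_noise_le h₁ h₂ i j hτ S B hgM).trans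
            (mul_le_mul_right (lintegral_noiseFactor_le hp hq hκ S B hSB) _)
    _ = ENNReal.ofReal (7 * (r : ℝ) ^ 3 * (1 + κ * C) * τ) := by
        simp only [Finset.sum_const, Finset.card_univ, Fintype.card_fin, nsmul_eq_mul]
        rw [← ENNReal.ofReal_natCast, ← ENNReal.ofReal_mul (by positivity),
          ← ENNReal.ofReal_mul (Nat.cast_nonneg r), ← ENNReal.ofReal_mul (Nat.cast_nonneg r)]
        congr 1
        ring

end LatentIntegrals

/-! ### Mean and concentration of the column projections. -/

section ColumnProjection

variable {p₀ q₀ p q : ℕ}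

lemma measurable_columnProj (h : 0 < q₀) (i j : Fin p₀) :
    Measurable fun z : LatentSpace p₀ q₀ p q => columnProj h i j z := by
  unfold columnProj
  fun_prop

lemma abs_columnProj_le_one (h : 0 < q₀) (i j : Fin p₀) (z : LatentSpace p₀ q₀ p q) :
    |columnProj h i j z| ≤ 1 := by
  set v : Fin p₀ → ℝ := fun k => z (Sum.inl (k, ⟨0, h⟩)) with hv
  have hi : v i ^ 2 ≤ ∑ k, v k ^ 2 :=
    Finset.single_le_sum (fun k _ => sq_nonneg (v k)) (Finset.mem_univ i)
  have hj : v j ^ 2 ≤ ∑ k, v k ^ 2 :=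
    Finset.single_le_sum (fun k _ => sq_nonneg (v k)) (Finset.mem_univ j)
  have hs : 0 ≤ ∑ k, v k ^ 2 := Finset.sum_nonneg fun k _ => sq_nonneg _
  change |v i * v j / ∑ k, v k ^ 2| ≤ 1
  rw [abs_div, abs_of_nonneg hs]
  refine div_le_one_of_le₀ ?_ hs
  rw [abs_le]
  constructor <;> nlinarith [sq_nonneg (v i + v j), sq_nonneg (v i - v j)]

lemma integrable_columnProj (h : 0 < q₀) (i j : Fin p₀) :
    Integrable (fun z : LatentSpace p₀ q₀ p q => columnProj h i j z) (stdGaussian _) :=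
  Integrable.of_bound (measurable_columnProj h i j).aestronglyMeasurable 1
    (Eventually.of_forall fun z => by simpa using abs_columnProj_le_one h i j z)

lemma integral_comp_isometry_stdGaussian {ι : Type*} [Fintype ι]
    (φ : EuclideanSpace ℝ ι ≃ₗᵢ[ℝ] EuclideanSpace ℝ ι) (f : EuclideanSpace ℝ ι → ℝ) :
    ∫ z, f (φ z) ∂(stdGaussian (EuclideanSpace ℝ ι)) =
      ∫ z, f z ∂(stdGaussian (EuclideanSpace ℝ ι)) := by
  conv_rhs => rw [← stdGaussian_map φ]
  exact (integral_map_equiv φ.toHomeomorph.toMeasurableEquiv f).symm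

/-- Flipping the sign of coordinate i preserves the Gaussian law and changes the sign of the
integrand. -/
lemma integral_columnProj_of_ne (h : 0 < q₀) {i j : Fin p₀} (hij : i ≠ j) :
    ∫ z : LatentSpace p₀ q₀ p q, columnProj h i j z ∂(stdGaussian _) = 0 := by
  classical
  let φ : LatentSpace p₀ q₀ p q ≃ₗᵢ[ℝ] LatentSpace p₀ q₀ p q :=
    LinearIsometryEquiv.piLpCongrRight 2 fun x =>
      if x = Sum.inl (i, ⟨0, h⟩) then LinearIsometryEquiv.neg ℝ else LinearIsometryEquiv.refl ℝ ℝ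
  have hφ : ∀ z x, φ z x = if x = Sum.inl (i, ⟨0, h⟩) then -z x else z x := by
    intro z x
    simp only [φ, LinearIsometryEquiv.piLpCongrRight_apply]
    split_ifs <;> simp
  have h1 := integral_comp_isometry_stdGaussian φ fun z => columnProj h i j z
  have h2 : ∀ z, columnProj h i j (φ z) = - columnProj h i j z := by
    intro z
    have h3 : ∀ k, φ z (Sum.inl (k, ⟨0, h⟩)) ^ 2 = z (Sum.inl (k, ⟨0, h⟩)) ^ 2 := by
      intro k
      rw [hφ]
      split_ifs <;> ring
    simp only [columnProj, h3]
    rw [hφ, hφ, if_pos rfl, if_neg (by simpa using hij.symm)]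
    ring
  simp only [h2, integral_neg] at h1
  linarith

/-- Swapping coordinates shows that the p₀ diagonal means agree, and they sum to 1. -/
lemma integral_columnProj_self (h : 0 < q₀) (i : Fin p₀) :
    ∫ z : LatentSpace p₀ q₀ p q, columnProj h i i z ∂(stdGaussian _) = 1 / (p₀ : ℝ) := by
  classical
  have hp₀ : 0 < p₀ := i.pos
  have hsym : ∀ k, ∫ z : LatentSpace p₀ q₀ p q, columnProj h k k z ∂(stdGaussian _) =
      ∫ z : LatentSpace p₀ q₀ p q, columnProj h i i z ∂(stdGaussian _) := by
    intro k
    let σ : Equiv.Perm ((Fin p₀ × Fin q₀) ⊕ (Fin p × Fin q)) :=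
      Equiv.sumCongr (Equiv.prodCongr (Equiv.swap i k) (Equiv.refl _)) (Equiv.refl _)
    let φ : LatentSpace p₀ q₀ p q ≃ₗᵢ[ℝ] LatentSpace p₀ q₀ p q :=
      LinearIsometryEquiv.piLpCongrLeft 2 ℝ ℝ σ
    have hφ : ∀ z l, φ z (Sum.inl (l, ⟨0, h⟩)) = z (Sum.inl (Equiv.swap i k l, ⟨0, h⟩)) := by
      intro z l
      simp [φ, σ, LinearIsometryEquiv.piLpCongrLeft_apply, Equiv.piCongrLeft'_apply]
    rw [← integral_comp_isometry_stdGaussian φ fun z => columnProj h i i z]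
    refine integral_congr_ae (Eventually.of_forall fun z => ?_)
    simp only [columnProj, hφ, Equiv.swap_apply_left]
    congr 1
    exact (Equiv.sum_comp (Equiv.swap i k) fun l => z (Sum.inl (l, ⟨0, h⟩)) ^ 2).symm
  have hsum : ∑ k, ∫ z : LatentSpace p₀ q₀ p q, columnProj h k k z ∂(stdGaussian _) = 1 := by
    rw [← integral_finsetSum _ fun k _ => integrable_columnProj h k k]
    have hae : ∀ᵐ z ∂(stdGaussian (LatentSpace p₀ q₀ p q)), ∑ k, columnProj h k k z = 1 := by
      -- The 1 × 1 leading block is the first entry of the column, so the column is nonzero almost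
      -- surely.
      filter_upwards [ae_leadingBlock_det_ne_zero (r := 1) (p := p) (q := q) hp₀ h] with z hz
      have hz' : z (Sum.inl (⟨0, hp₀⟩, ⟨0, h⟩)) ≠ 0 := by
        rw [Matrix.det_fin_one] at hz
        exact hz
      have hpos : 0 < ∑ k, z (Sum.inl (k, ⟨0, h⟩)) ^ 2 :=
        lt_of_lt_of_le (by positivity)
          (Finset.single_le_sum (f := fun k => z (Sum.inl (k, ⟨0, h⟩)) ^ 2)
            (fun k _ => sq_nonneg _) (Finset.mem_univ ⟨0, hp₀⟩))
      simp only [columnProj, ← Finset.sum_div, ← sq]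
      exact div_self hpos.ne'
    rw [integral_congr_ae hae]
    simp
  simp only [hsym, Finset.sum_const, Finset.card_univ, Fintype.card_fin, nsmul_eq_mul] at hsum
  rw [eq_div_iff (by positivity)]
  linarith

/-- Chebyshev bound for averages of bounded independent identically distributed variables. -/
lemma measure_average_sub_ge_le {Ω : Type*} [MeasurableSpace Ω] {μ : Measure Ω}
    [IsProbabilityMeasure μ] {T : ℕ} (hT : 0 < T) {ξ : Fin T → Ω → ℝ}
    (hξ : ∀ t, Measurable (ξ t)) (hbound : ∀ t ω, |ξ t ω| ≤ 1) {m : ℝ}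
    (hmean : ∀ t, ∫ ω, ξ t ω ∂μ = m)
    (hind : Pairwise fun s t => IndepFun (ξ s) (ξ t) μ) {ε : ℝ} (hε : 0 < ε) :
    μ {ω | ε ≤ |(1 / (T : ℝ)) * ∑ t, ξ t ω - m|} ≤ ENNReal.ofReal (1 / (ε ^ 2 * T)) := by
  have hT' : (0 : ℝ) < T := by exact_mod_cast hT
  have hL : ∀ t, MemLp (ξ t) 2 μ := fun t =>
    MemLp.of_bound (hξ t).aestronglyMeasurable 1
      (Eventually.of_forall fun ω => by simpa using hbound t ω)
  have hsum : MemLp (∑ t, ξ t) 2 μ := memLp_finsetSum' _ fun t _ => hL t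
  have hint : ∫ ω, (∑ t, ξ t) ω ∂μ = T * m := by
    simp only [Finset.sum_apply]
    rw [integral_finsetSum _ fun t _ => (hL t).integrable (by norm_num)]
    simp [hmean]
  have hvar : Var[∑ t, ξ t; μ] ≤ T := by
    rw [IndepFun.variance_sum (fun t _ => hL t) fun s _ t _ hst => hind hst]
    calc ∑ t, Var[ξ t; μ] ≤ ∑ _t : Fin T, (1 : ℝ) := by
          refine Finset.sum_le_sum fun t _ => ?_
          refine (variance_le_expectation_sq (hL t).aestronglyMeasurable).trans ?_
          calc ∫ ω, (ξ t ^ 2) ω ∂μ ≤ ∫ _ω, (1 : ℝ) ∂μ := by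
                refine integral_mono (hL t).integrable_sq (integrable_const _) fun ω => ?_
                simpa [sq_le_one_iff_abs_le_one] using hbound t ω
            _ = 1 := by simp
      _ = T := by simp
  have hcheb := meas_ge_le_variance_div_sq hsum (c := ε * T) (by positivity)
  rw [hint] at hcheb
  calc μ {ω | ε ≤ |(1 / (T : ℝ)) * ∑ t, ξ t ω - m|}
      ≤ μ {ω | ε * T ≤ |(∑ t, ξ t) ω - T * m|} := by
        refine measure_mono fun ω hω => ?_
        simp only [Set.mem_ofPred_eq, Finset.sum_apply] at hω ⊢
        have : ∑ t, ξ t ω - T * m = ((1 / (T : ℝ)) * ∑ t, ξ t ω - m) * T := by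
          field_simp
        rw [this, abs_mul, abs_of_pos hT']
        exact mul_le_mul_of_nonneg_right hω hT'.le
    _ ≤ ENNReal.ofReal (Var[∑ t, ξ t; μ] / (ε * T) ^ 2) := hcheb
    _ ≤ ENNReal.ofReal (1 / (ε ^ 2 * T)) := by
        refine ENNReal.ofReal_le_ofReal ?_
        calc Var[∑ t, ξ t; μ] / (ε * T) ^ 2 ≤ T / (ε * T) ^ 2 := by gcongr
          _ = 1 / (ε ^ 2 * T) := by field_simp

end ColumnProjection

/-! ### Conditioning on the previous estimate, and its nondegeneracy event. -/

section Convergence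

/-- By independence the joint law is a product, so Fubini lets a random estimate be treated as
fixed. -/
lemma lintegral_comp_le_of_indepFun {Ω α β : Type*} [MeasurableSpace Ω] [MeasurableSpace α]
    [MeasurableSpace β] {μ : Measure Ω} [IsProbabilityMeasure μ] {f : Ω → α} {g : Ω → β}
    (hf : Measurable f) (hg : Measurable g) (hfg : IndepFun f g μ) {F : α × β → ENNReal}
    (hF : Measurable F) {K : ENNReal} (hK : ∀ ω, ∫⁻ z, F (f ω, z) ∂(μ.map g) ≤ K) :
    ∫⁻ ω, F (f ω, g ω) ∂μ ≤ K := by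
  have := Measure.isProbabilityMeasure_map (μ := μ) hg.aemeasurable
  rw [← lintegral_map hF (hf.prodMk hg),
    (indepFun_iff_map_prod_eq_prod_map_map hf.aemeasurable hg.aemeasurable).mp hfg,
    lintegral_prod _ hF.aemeasurable, lintegral_map hF.lintegral_prod_right' hf]
  calc ∫⁻ ω, ∫⁻ z, F (f ω, z) ∂(μ.map g) ∂μ ≤ ∫⁻ _ω, K ∂μ := lintegral_mono hK
    _ = K := by simp

variable {m k : ℕ}

lemma frame_of_normalized {L : Matrix (Fin m) (Fin k) ℝ}
    (h : (1 / (m : ℝ)) • (L.transpose * L) = 1) :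
    ((1 / Real.sqrt m) • L).transpose * ((1 / Real.sqrt m) • L) = 1 := by
  rw [Matrix.transpose_smul, Matrix.smul_mul, Matrix.mul_smul, smul_smul, ← h]
  congr 1
  rw [div_mul_div_comm, Real.mul_self_sqrt (Nat.cast_nonneg m), one_mul]

lemma frobSq_one_div_sqrt_smul (A : Matrix (Fin m) (Fin k) ℝ) :
    frobSq ((1 / Real.sqrt m) • A) = frobSq A / m := by
  rw [frobSq_smul, div_pow, Real.sq_sqrt (Nat.cast_nonneg m)]
  ring

lemma frobSq_of_normalized (hm : 0 < m) {L : Matrix (Fin m) (Fin k) ℝ}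
    (h : (1 / (m : ℝ)) • (L.transpose * L) = 1) : frobSq L = k * m := by
  have h1 := frobSq_frame (frame_of_normalized h)
  have hm' : (0 : ℝ) < m := by exact_mod_cast hm
  rw [frobSq_one_div_sqrt_smul, div_eq_iff hm'.ne'] at h1
  exact h1

/-- An intersection over uncountably many x; each condition is closed, which gives measurability. -/
lemma measurableSet_mulVec_lower_bound (C : Matrix (Fin m) (Fin k) ℝ) (c : ℝ) :
    MeasurableSet {B : Fin m → Fin k → ℝ | ∀ x : Fin k → ℝ, c * (x ⬝ᵥ x) ≤
      (((1 / (m : ℝ)) • (C.transpose * Matrix.of B)).mulVec x) ⬝ᵥ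
        (((1 / (m : ℝ)) • (C.transpose * Matrix.of B)).mulVec x)} := by
  refine IsClosed.measurableSet ?_
  rw [Set.ofPred_forall]
  refine isClosed_iInter fun x => isClosed_le continuous_const ?_
  simp only [dotProduct, Matrix.mulVec, Matrix.smul_apply, Matrix.mul_apply, Matrix.of_apply]
  fun_prop

/-- The event stated with `singVal` is not shown to be measurable. It is contained in the measurable
event G n, whose complement can be measured. -/
lemma tendsto_measure_not_lower_bound {Ω : ℕ → Type*} [∀ n, MeasurableSpace (Ω n)]
    {μ : ∀ n, Measure (Ω n)} [∀ n, IsProbabilityMeasure (μ n)] {k : ℕ} (hk : 0 < k) {m : ℕ → ℕ}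
    {L : ∀ n, Matrix (Fin (m n)) (Fin k) ℝ} {Lhat : ∀ n, Ω n → Matrix (Fin (m n)) (Fin k) ℝ}
    (hmeas : ∀ n, Measurable (fun ω i j => Lhat n ω i j)) {c : ℝ} (hc : 0 < c)
    (h : Tendsto (fun n => μ n {ω | c ≤ singVal k ((L n).transpose * Lhat n ω) / (m n : ℝ)})
      atTop (𝓝 1)) :
    Tendsto (fun n => μ n {ω | ¬ ∀ x : Fin k → ℝ, c ^ 2 * (x ⬝ᵥ x) ≤
      (((1 / (m n : ℝ)) • ((L n).transpose * Lhat n ω)).mulVec x) ⬝ᵥ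
        (((1 / (m n : ℝ)) • ((L n).transpose * Lhat n ω)).mulVec x)}) atTop (𝓝 0) := by
  set G : ∀ n, Set (Ω n) := fun n => {ω | ∀ x : Fin k → ℝ, c ^ 2 * (x ⬝ᵥ x) ≤
      (((1 / (m n : ℝ)) • ((L n).transpose * Lhat n ω)).mulVec x) ⬝ᵥ
        (((1 / (m n : ℝ)) • ((L n).transpose * Lhat n ω)).mulVec x)} with hG
  have hGm : ∀ n, MeasurableSet (G n) := fun n =>
    hmeas n (measurableSet_mulVec_lower_bound (L n) (c ^ 2))
  have hsub : ∀ n, {ω | c ≤ singVal k ((L n).transpose * Lhat n ω) / (m n : ℝ)} ⊆ G n := by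
    intro n ω hω x
    have h1 := singVal_sq_mul_le hk ((L n).transpose * Lhat n ω) x
    have h2 : c ^ 2 ≤ (singVal k ((L n).transpose * Lhat n ω) / (m n : ℝ)) ^ 2 :=
      pow_le_pow_left₀ hc.le hω 2
    rw [Matrix.smul_mulVec, smul_dotProduct, dotProduct_smul, smul_eq_mul, smul_eq_mul]
    calc c ^ 2 * (x ⬝ᵥ x)
        ≤ (singVal k ((L n).transpose * Lhat n ω) / (m n : ℝ)) ^ 2 * (x ⬝ᵥ x) :=
          mul_le_mul_of_nonneg_right h2 (dotProduct_self_nonneg' x)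
      _ = (1 / (m n : ℝ)) ^ 2 *
          (singVal k ((L n).transpose * Lhat n ω) ^ 2 * (x ⬝ᵥ x)) := by ring
      _ ≤ (1 / (m n : ℝ)) ^ 2 * _ := mul_le_mul_of_nonneg_left h1 (sq_nonneg _)
      _ = _ := by ring
  have hG1 : Tendsto (fun n => μ n (G n)) atTop (𝓝 1) :=
    tendsto_of_tendsto_of_tendsto_of_le_of_le h tendsto_const_nhds
      (fun n => measure_mono (hsub n)) fun n => prob_le_one
  have h2 : ∀ n, μ n (G n)ᶜ = 1 - μ n (G n) := fun n => prob_compl_eq_one_sub (hGm n)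
  have h3 : Tendsto (fun n => 1 - μ n (G n)) atTop (𝓝 (1 - 1)) :=
    ENNReal.Tendsto.sub tendsto_const_nhds hG1 (Or.inl ENNReal.one_ne_top)
  rw [tsub_self] at h3
  simp only [← h2] at h3
  exact h3

end Convergence

/-! ### Probability bounds for the mean loss and the column averages. -/

section Rate

variable {p₀ q₀ : ℕ} {Ω : Type*} [MeasurableSpace Ω] {μ : Measure Ω} [IsProbabilityMeasure μ]
  {T p q : ℕ}

lemma lintegral_average_lossBound_le (hT : 0 < T) (hp : 0 < p) (hq : 0 < q)
    {Z : Fin T → Ω → LatentSpace p₀ q₀ p q} (hZ : ∀ t, Measurable (Z t))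
    (hlaw : ∀ t, μ.map (Z t) = stdGaussian (LatentSpace p₀ q₀ p q))
    {B : Ω → Matrix (Fin q) (Fin q₀) ℝ} (hB : Measurable (fun ω i j => B ω i j))
    (hBn : ∀ ω, (1 / (q : ℝ)) • ((B ω).transpose * B ω) = 1)
    (hBZ : ∀ t, IndepFun (fun ω i j => B ω i j) (Z t) μ)
    {Om : Matrix (Fin q) (Fin q) ℝ} {c C : ℝ} (hc : 0 ≤ c) (hC : 0 ≤ C) (hOm : SpectrumIn Om c C)
    {κ : ℝ} (hκ : 0 ≤ κ) :
    ∫⁻ ω, ENNReal.ofReal ((1 / (T : ℝ)) * ∑ t, lossBound (min_le_left p₀ q₀) (min_le_right p₀ q₀)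
        κ (CFC.sqrt Om) (B ω) (Z t ω)) ∂μ ≤
      ENNReal.ofReal (7 * ((min p₀ q₀ : ℕ) : ℝ) ^ 3 * (1 + κ * (C * q₀)) *
        (q : ℝ) ^ (-1 / 2 : ℝ)) := by
  set K := 7 * ((min p₀ q₀ : ℕ) : ℝ) ^ 3 * (1 + κ * (C * q₀)) * (q : ℝ) ^ (-1 / 2 : ℝ) with hK
  have hK0 : 0 ≤ K := by positivity
  have hT' : (0 : ℝ) < T := by exact_mod_cast hT
  -- The normalization of the estimate gives ‖B‖² = q₀q.
  have hSB : ∀ ω, frobSq (CFC.sqrt Om * B ω) ≤ (C * q₀) * q := by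
    intro ω
    refine (frobSq_mul_le_of_mulVec_le (fun x => (hOm.sqrt_bounds hc x).2) (B ω)).trans_eq ?_
    rw [frobSq_of_normalized hq (hBn ω), mul_assoc]
  have hterm : ∀ t, ∫⁻ ω, ENNReal.ofReal (lossBound (min_le_left p₀ q₀) (min_le_right p₀ q₀)
      κ (CFC.sqrt Om) (B ω) (Z t ω)) ∂μ ≤ ENNReal.ofReal K := by
    intro t
    refine lintegral_comp_le_of_indepFun hB (hZ t) (hBZ t)
      (measurable_lossBound (min_le_left p₀ q₀) (min_le_right p₀ q₀) κ
        (CFC.sqrt Om)).ennreal_ofReal fun ω => ?_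
    rw [hlaw t]
    exact lintegral_lossBound_le _ _ hp hq hκ _ (B ω) (hSB ω)
  have hmeas : ∀ t, Measurable fun ω => ENNReal.ofReal (lossBound (min_le_left p₀ q₀)
      (min_le_right p₀ q₀) κ (CFC.sqrt Om) (B ω) (Z t ω)) := fun t =>
    ((measurable_lossBound (min_le_left p₀ q₀) (min_le_right p₀ q₀) κ
        (CFC.sqrt Om)).comp (hB.prodMk (hZ t))).ennreal_ofReal
  have hpt : ∀ ω, ENNReal.ofReal ((1 / (T : ℝ)) * ∑ t, lossBound (min_le_left p₀ q₀)
      (min_le_right p₀ q₀) κ (CFC.sqrt Om) (B ω) (Z t ω)) =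
      ENNReal.ofReal (1 / T) * ∑ t, ENNReal.ofReal (lossBound (min_le_left p₀ q₀)
      (min_le_right p₀ q₀) κ (CFC.sqrt Om) (B ω) (Z t ω)) := by
    intro ω
    rw [ENNReal.ofReal_mul (by positivity),
      ENNReal.ofReal_sum_of_nonneg fun t _ => lossBound_nonneg _ _ hκ _ _ _]
  simp only [hpt]
  rw [lintegral_const_mul' _ _ ENNReal.ofReal_ne_top, lintegral_finsetSum _ fun t _ => hmeas t]
  calc ENNReal.ofReal (1 / T) * ∑ t, ∫⁻ ω, ENNReal.ofReal (lossBound (min_le_left p₀ q₀)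
        (min_le_right p₀ q₀) κ (CFC.sqrt Om) (B ω) (Z t ω)) ∂μ
      ≤ ENNReal.ofReal (1 / T) * ∑ _t : Fin T, ENNReal.ofReal K :=
        mul_le_mul_right (Finset.sum_le_sum fun t _ => hterm t) _
    _ = ENNReal.ofReal K := by
        rw [Finset.sum_const, Finset.card_univ, Fintype.card_fin, nsmul_eq_mul,
          ← ENNReal.ofReal_natCast, ← ENNReal.ofReal_mul hT'.le,
          ← ENNReal.ofReal_mul (by positivity)]
        congr 1
        field_simp

lemma measure_columnProj_average_far_le (hq₀ : 0 < q₀) (hT : 0 < T)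
    {Z : Fin T → Ω → LatentSpace p₀ q₀ p q} (hZ : ∀ t, Measurable (Z t))
    (hlaw : ∀ t, μ.map (Z t) = stdGaussian (LatentSpace p₀ q₀ p q))
    (hind : Pairwise fun s t => IndepFun (Z s) (Z t) μ) {δ : ℝ} (hδ : 0 < δ) :
    μ {ω | ¬ ∀ i j, |(1 / (T : ℝ)) * ∑ t, columnProj hq₀ i j (Z t ω) -
      (if i = j then 1 / (p₀ : ℝ) else 0)| ≤ δ} ≤
      ENNReal.ofReal ((p₀ : ℝ) ^ 2 * (1 / (δ ^ 2 * T))) := by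
  have hmean : ∀ i j t, ∫ ω, columnProj hq₀ i j (Z t ω) ∂μ =
      if i = j then 1 / (p₀ : ℝ) else 0 := by
    intro i j t
    rw [← integral_map (f := fun z => columnProj hq₀ i j z) (hZ t).aemeasurable
      (measurable_columnProj hq₀ i j).aestronglyMeasurable, hlaw t]
    split_ifs with h
    · subst h; exact integral_columnProj_self hq₀ i
    · exact integral_columnProj_of_ne hq₀ h
  have hij : ∀ i j, μ {ω | δ ≤ |(1 / (T : ℝ)) * ∑ t, columnProj hq₀ i j (Z t ω) -
      (if i = j then 1 / (p₀ : ℝ) else 0)|} ≤ ENNReal.ofReal (1 / (δ ^ 2 * T)) := fun i j =>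
    measure_average_sub_ge_le hT (fun t => (measurable_columnProj hq₀ i j).comp (hZ t))
      (fun t ω => abs_columnProj_le_one hq₀ i j _) (hmean i j)
      (fun s t hst => (hind hst).comp (measurable_columnProj hq₀ i j)
        (measurable_columnProj hq₀ i j)) hδ
  calc μ {ω | ¬ ∀ i j, |(1 / (T : ℝ)) * ∑ t, columnProj hq₀ i j (Z t ω) -
        (if i = j then 1 / (p₀ : ℝ) else 0)| ≤ δ}
      ≤ μ (⋃ x : Fin p₀ × Fin p₀, {ω | δ ≤ |(1 / (T : ℝ)) * ∑ t, columnProj hq₀ x.1 x.2 (Z t ω) -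
        (if x.1 = x.2 then 1 / (p₀ : ℝ) else 0)|}) := by
        refine measure_mono fun ω hω => ?_
        simp only [Set.mem_ofPred_eq, not_forall, not_le] at hω
        obtain ⟨i, j, h⟩ := hω
        exact Set.mem_iUnion.mpr ⟨(i, j), h.le⟩
    _ ≤ ∑ x : Fin p₀ × Fin p₀, ENNReal.ofReal (1 / (δ ^ 2 * T)) :=
        (measure_iUnion_fintype_le _ _).trans (Finset.sum_le_sum fun x _ => hij x.1 x.2)
    _ = ENNReal.ofReal ((p₀ : ℝ) ^ 2 * (1 / (δ ^ 2 * T))) := by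
        rw [Finset.sum_const, Finset.card_univ, Fintype.card_prod, Fintype.card_fin,
          nsmul_eq_mul, ← ENNReal.ofReal_natCast, ← ENNReal.ofReal_mul (by positivity)]
        push_cast
        rw [← sq]

end Rate

/-! ### Assembling the rate. -/

section Consistency

/-- The projection effect for one of the two loading matrices. -/
theorem exists_rotation_isBigOp {p₀ q₀ : ℕ} (hp₀ : 0 < p₀) (hq₀ : 0 < q₀)
    {T p q : ℕ → ℕ} (hT : Tendsto T atTop atTop) (hp : Tendsto p atTop atTop)
    (hq : Tendsto q atTop atTop)
    {Ω : ℕ → Type*} [∀ n, MeasurableSpace (Ω n)] {μ : ∀ n, Measure (Ω n)}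
    [∀ n, IsProbabilityMeasure (μ n)]
    {R : ∀ n, Matrix (Fin (p n)) (Fin p₀) ℝ} {C : ∀ n, Matrix (Fin (q n)) (Fin q₀) ℝ}
    {Sig₁ : ℕ → Matrix (Fin p₀) (Fin p₀) ℝ} {Sig₂ : ℕ → Matrix (Fin q₀) (Fin q₀) ℝ}
    {Om₁ : ∀ n, Matrix (Fin (p n)) (Fin (p n)) ℝ} {Om₂ : ∀ n, Matrix (Fin (q n)) (Fin (q n)) ℝ}
    {ρ : ∀ n, Fin (T n) → Ω n → ℝ}
    {Z : ∀ n, Fin (T n) → Ω n → LatentSpace p₀ q₀ (p n) (q n)}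
    (hρ : ∀ n t, ∀ᵐ ω ∂(μ n), 0 < ρ n t ω) (hZ : ∀ n t, Measurable (Z n t))
    (hlaw : ∀ n t, (μ n).map (Z n t) = stdGaussian (LatentSpace p₀ q₀ (p n) (q n)))
    (hind : ∀ n, Pairwise fun s t => IndepFun (Z n s) (Z n t) (μ n))
    (hR : ∀ n, (1 / (p n : ℝ)) • ((R n).transpose * R n) = 1)
    {c₁ C₁ c₂ C₂ : ℝ} (hc₁ : 0 < c₁) (hC₁ : 0 < C₁) (hc₂ : 0 < c₂) (hC₂ : 0 < C₂)
    (hSig : ∀ n, SpectrumIn (Sig₁ n) c₁ C₁ ∧ SpectrumIn (Sig₂ n) c₁ C₁)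
    (hOm : ∀ n, SpectrumIn (Om₁ n) c₂ C₂ ∧ SpectrumIn (Om₂ n) c₂ C₂)
    {Chat : ∀ n, Ω n → Matrix (Fin (q n)) (Fin q₀) ℝ}
    {Rnew : ∀ n, Ω n → Matrix (Fin (p n)) (Fin p₀) ℝ}
    (hCm : ∀ n, Measurable (fun ω i j => Chat n ω i j))
    (hCn : ∀ n ω, (1 / (q n : ℝ)) • ((Chat n ω).transpose * Chat n ω) = 1)
    (hCZ : ∀ n t, IndepFun (fun ω i j => Chat n ω i j) (Z n t) (μ n))
    {c : ℝ} (hc : 0 < c)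
    (hCc : Tendsto (fun n => μ n {ω | c ≤ singVal q₀ ((C n).transpose * Chat n ω) / (q n : ℝ)})
      atTop (𝓝 1))
    (hupd : ∀ n ω, IsMPCAFUpdate (min p₀ q₀) (fun t => observation (R n) (C n) (Sig₁ n) (Sig₂ n)
      (Om₁ n) (Om₂ n) (ρ n t ω) (Z n t ω)) (Chat n ω) (Rnew n ω)) :
    ∃ H : ∀ n, Ω n → Matrix (Fin p₀) (Fin p₀) ℝ,
      (∀ n ω, H n ω ∈ Matrix.orthogonalGroup (Fin p₀) ℝ) ∧
      IsBigOp μ (fun n ω => frobSq (Rnew n ω - R n * H n ω) / (p n : ℝ))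
        (fun n => (T n : ℝ)⁻¹ + (q n : ℝ) ^ (-1 / 2 : ℝ)) := by
  have hframe : ∀ n ω, ((1 / Real.sqrt (p n)) • Rnew n ω).transpose *
      ((1 / Real.sqrt (p n)) • Rnew n ω) = 1 := by
    intro n ω
    obtain ⟨U, -, hU⟩ := hupd n ω
    exact hU.frame
  choose H hH hHle using fun n ω =>
    exists_orthogonal_frobSq_sub_le (hframe n ω) (frame_of_normalized (hR n))
  refine ⟨H, hH, fun ε hε => ?_⟩
  have hp₀' : (0 : ℝ) < p₀ := by exact_mod_cast hp₀
  set d := c ^ 2 with hd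
  have hd0 : 0 < d := by positivity
  set κ := 4 * C₂ / (d * c₁ * c₁) with hκ
  have hκ0 : 0 < κ := by positivity
  set lam := c₁ / (2 * p₀ * C₁) with hlam
  have hlam0 : 0 < lam := by positivity
  set K := 7 * ((min p₀ q₀ : ℕ) : ℝ) ^ 3 * (1 + κ * (C₂ * q₀)) with hK
  have hK0 : 0 ≤ K := by positivity
  -- Chosen so that Markov's inequality bounds P(loss ≥ Na) by Ka/(Na) ≤ ε/3, where a = q^{-1/2}.
  set N := 3 * (K + 1) / ε with hN
  have hN0 : 0 < N := by positivity
  set δ : ℝ := 1 / (2 * (p₀ : ℝ) ^ 2) with hδ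
  have hδ0 : 0 < δ := by positivity
  -- Procrustes constant times the averaging constant times the Markov level.
  refine ⟨(4 * p₀ + 2) * (4 / lam * N), ?_⟩
  have hTr : Tendsto (fun n => (T n : ℝ)) atTop atTop := tendsto_natCast_atTop_atTop.comp hT
  have hqr : Tendsto (fun n => (q n : ℝ)) atTop atTop := tendsto_natCast_atTop_atTop.comp hq
  have hrate : Tendsto (fun n => N * (q n : ℝ) ^ (-1 / 2 : ℝ)) atTop (𝓝 0) := by
    have h1 := ((tendsto_rpow_neg_atTop (y := 1 / 2) (by norm_num)).comp hqr).const_mul N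
    rw [mul_zero] at h1
    refine h1.congr fun n => ?_
    simp only [Function.comp_apply]
    norm_num
  have hcheb : Tendsto (fun n => (p₀ : ℝ) ^ 2 * (1 / (δ ^ 2 * T n))) atTop (𝓝 0) := by
    have h1 := (tendsto_inv_atTop_zero.comp hTr).const_mul ((p₀ : ℝ) ^ 2 * (1 / δ ^ 2))
    rw [mul_zero] at h1
    refine h1.congr fun n => ?_
    simp only [Function.comp_apply]
    rw [one_div, one_div, mul_inv, mul_assoc]
  have hε3 : (0 : ENNReal) < ENNReal.ofReal (ε / 3) := by
    rw [ENNReal.ofReal_pos]; positivity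
  filter_upwards [hT.eventually_gt_atTop 0, hp.eventually_gt_atTop 0, hq.eventually_gt_atTop 0,
    hrate.eventually_le_const (u := lam / 8) (by positivity),
    hcheb.eventually_le_const (u := ε / 3) (by positivity),
    (tendsto_measure_not_lower_bound hq₀ hCm hc hCc).eventually_le_const hε3]
    with n hTn hpn hqn hrn hcn hbn
  set a := (q n : ℝ) ^ (-1 / 2 : ℝ) with ha
  have ha0 : 0 < a := Real.rpow_pos_of_pos (by exact_mod_cast hqn) _
  set loss : Ω n → ℝ := fun ω => (1 / (T n : ℝ)) * ∑ t,
    lossBound (min_le_left p₀ q₀) (min_le_right p₀ q₀) κ (CFC.sqrt (Om₂ n)) (Chat n ω) (Z n t ω)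
    with hloss
  set A₁ : Set (Ω n) := {ω | ¬ ∀ x : Fin q₀ → ℝ, d * (x ⬝ᵥ x) ≤
    (((1 / (q n : ℝ)) • ((C n).transpose * Chat n ω)).mulVec x) ⬝ᵥ
      (((1 / (q n : ℝ)) • ((C n).transpose * Chat n ω)).mulVec x)} with hA₁
  set A₂ : Set (Ω n) := {ω | ENNReal.ofReal (N * a) ≤ ENNReal.ofReal (loss ω)} with hA₂
  set A₃ : Set (Ω n) := {ω | ¬ ∀ i j, |(1 / (T n : ℝ)) * ∑ t, columnProj hq₀ i j (Z n t ω) -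
    (if i = j then 1 / (p₀ : ℝ) else 0)| ≤ δ} with hA₃
  have h2 : μ n A₂ ≤ ENNReal.ofReal (ε / 3) := by
    have hmeas : Measurable fun ω => ENNReal.ofReal (loss ω) :=
      ((Finset.measurable_sum _ fun t _ => (measurable_lossBound (min_le_left p₀ q₀)
        (min_le_right p₀ q₀) κ (CFC.sqrt (Om₂ n))).comp
          ((hCm n).prodMk (hZ n t))).const_mul _).ennreal_ofReal
    refine (meas_ge_le_lintegral_div hmeas.aemeasurable
      (ENNReal.ofReal_pos.mpr (mul_pos hN0 ha0)).ne' ENNReal.ofReal_ne_top).trans ?_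
    have h4 := lintegral_average_lossBound_le hTn hpn hqn (hZ n) (hlaw n) (hCm n) (hCn n) (hCZ n)
      hc₂.le hC₂.le (hOm n).2 hκ0.le
    refine (ENNReal.div_le_div_right h4 _).trans ?_
    rw [← ENNReal.ofReal_div_of_pos (mul_pos hN0 ha0)]
    refine ENNReal.ofReal_le_ofReal ?_
    rw [div_le_iff₀ (mul_pos hN0 ha0), hN]
    have h5 : ε / 3 * (3 * (K + 1) / ε * a) = (K + 1) * a := by field_simp
    rw [h5]
    exact mul_le_mul_of_nonneg_right (by linarith) ha0.le
  have h3 : μ n A₃ ≤ ENNReal.ofReal (ε / 3) :=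
    (measure_columnProj_average_far_le hq₀ hTn (hZ n) (hlaw n) (hind n) hδ0).trans
      (ENNReal.ofReal_le_ofReal hcn)
  have hae : ∀ᵐ ω ∂(μ n), ∀ t, 0 < ρ n t ω ∧ (leadingBlock (min_le_left p₀ q₀)
      (min_le_right p₀ q₀) (latentFactor (Z n t ω))).det ≠ 0 := by
    rw [ae_all_iff]
    intro t
    have h4 := ae_leadingBlock_det_ne_zero (p := p n) (q := q n) (min_le_left p₀ q₀)
      (min_le_right p₀ q₀)
    rw [← hlaw n t] at h4
    exact (hρ n t).and (ae_of_ae_map (hZ n t).aemeasurable h4)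
  -- Almost surely outside the three exceptional sets (degenerate estimate, large mean loss,
  -- atypical column directions) the deterministic bound applies. Each set has probability at most
  -- ε/3.
  have hsub : {ω | (4 * p₀ + 2) * (4 / lam * N) * ((T n : ℝ)⁻¹ + a) <
      |frobSq (Rnew n ω - R n * H n ω) / (p n : ℝ)|} ≤ᵐ[μ n] (A₁ ∪ A₂ ∪ A₃ : Set (Ω n)) := by
    filter_upwards [hae] with ω hω hlt
    by_contra hnot
    have hnot' : ω ∉ A₁ ∪ A₂ ∪ A₃ := hnot
    simp only [Set.mem_union, not_or] at hnot'
    obtain ⟨⟨hn1, hn2⟩, hn3⟩ := hnot'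
    replace hn1 := not_not.mp hn1
    replace hn3 := not_not.mp hn3
    have hD : loss ω ≤ N * a := by
      by_contra h
      exact hn2 (ENNReal.ofReal_le_ofReal (not_le.mp h).le)
    have hz : ∀ t, Z n t ω ≠ 0 := by
      intro t h0
      refine (hω t).2 ?_
      have : Nonempty (Fin (min p₀ q₀)) := ⟨⟨0, lt_min hp₀ hq₀⟩⟩
      have hblock : leadingBlock (min_le_left p₀ q₀) (min_le_right p₀ q₀)
          (latentFactor (Z n t ω)) = 0 := by
        ext i j
        simp [leadingBlock, latentFactor, h0]
      rw [hblock]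
      exact Matrix.det_zero
    have h4 := (hupd n ω).frobSq_defect_le hp₀ hq₀ hTn hpn hqn (frame_of_normalized (hR n)) hc₁ hC₁
      hc₂.le (hSig n).1 (hSig n).2 (hOm n).1 (fun t => (hω t).1) hz (fun t => (hω t).2) hd0 hn1
      hD hrn hn3
    have h5 := hHle n ω
    rw [Matrix.smul_mul, ← smul_sub, frobSq_one_div_sqrt_smul] at h5
    have h6 : |frobSq (Rnew n ω - R n * H n ω) / (p n : ℝ)| ≤
        (4 * p₀ + 2) * (4 / lam * N) * ((T n : ℝ)⁻¹ + a) := by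
      rw [abs_of_nonneg (div_nonneg (frobSq_nonneg _) (Nat.cast_nonneg _))]
      calc frobSq (Rnew n ω - R n * H n ω) / (p n : ℝ)
          ≤ (4 * p₀ + 2) * (4 / lam * (N * a)) :=
            h5.trans (mul_le_mul_of_nonneg_left h4 (by positivity))
        _ = (4 * p₀ + 2) * (4 / lam * N) * a := by ring
        -- The q^{-1/2} bound is already proved; the nonnegative T⁻¹ is added.
        _ ≤ (4 * p₀ + 2) * (4 / lam * N) * ((T n : ℝ)⁻¹ + a) := by
            refine mul_le_mul_of_nonneg_left ?_ (by positivity)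
            have : (0 : ℝ) ≤ (T n : ℝ)⁻¹ := by positivity
            linarith
    exact absurd hlt (not_lt.mpr h6)
  calc μ n {ω | (4 * p₀ + 2) * (4 / lam * N) * ((T n : ℝ)⁻¹ + a) <
        |frobSq (Rnew n ω - R n * H n ω) / (p n : ℝ)|}
      ≤ μ n (A₁ ∪ A₂ ∪ A₃) := measure_mono_ae hsub
    _ ≤ μ n A₁ + μ n A₂ + μ n A₃ :=
        (measure_union_le _ _).trans (add_le_add_left (measure_union_le _ _) _)
    _ ≤ ENNReal.ofReal (ε / 3) + ENNReal.ofReal (ε / 3) + ENNReal.ofReal (ε / 3) :=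
        add_le_add (add_le_add hbn h2) h3
    _ = ENNReal.ofReal ε := by
        rw [← ENNReal.ofReal_add (by positivity) (by positivity),
          ← ENNReal.ofReal_add (by positivity) (by positivity)]
        congr 1
        ring

end Consistency

/-! ### Exchanging rows and columns. -/

section Transposition

variable {p₀ q₀ p q : ℕ}

/-- Transposition of both latent matrices. -/
noncomputable def latentTranspose (p₀ q₀ p q : ℕ) :
    LatentSpace p₀ q₀ p q ≃ₗᵢ[ℝ] LatentSpace q₀ p₀ q p :=
  LinearIsometryEquiv.piLpCongrLeft 2 ℝ ℝ
    (Equiv.sumCongr (Equiv.prodComm _ _) (Equiv.prodComm _ _))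

lemma latentFactor_latentTranspose (z : LatentSpace p₀ q₀ p q) :
    latentFactor (latentTranspose p₀ q₀ p q z) = (latentFactor z).transpose := by
  ext i j
  simp [latentFactor, latentTranspose, LinearIsometryEquiv.piLpCongrLeft_apply,
    Equiv.piCongrLeft'_apply]

lemma latentNoise_latentTranspose (z : LatentSpace p₀ q₀ p q) :
    latentNoise (latentTranspose p₀ q₀ p q z) = (latentNoise z).transpose := by
  ext i j
  simp [latentNoise, latentTranspose, LinearIsometryEquiv.piLpCongrLeft_apply,
    Equiv.piCongrLeft'_apply]

/-- Transposing the latent matrices is a linear isometry, so ‖z‖ is unchanged and the transposed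
data follow the same model with the roles of p and q exchanged. -/
lemma observation_transpose (R : Matrix (Fin p) (Fin p₀) ℝ) (C : Matrix (Fin q) (Fin q₀) ℝ)
    (Sig₁ : Matrix (Fin p₀) (Fin p₀) ℝ) (Sig₂ : Matrix (Fin q₀) (Fin q₀) ℝ)
    (Om₁ : Matrix (Fin p) (Fin p) ℝ) (Om₂ : Matrix (Fin q) (Fin q) ℝ)
    (ρ : ℝ) (z : LatentSpace p₀ q₀ p q) :
    (observation R C Sig₁ Sig₂ Om₁ Om₂ ρ z).transpose =
      observation C R Sig₂ Sig₁ Om₂ Om₁ ρ (latentTranspose p₀ q₀ p q z) := by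
  simp only [observation, latentFactor_latentTranspose, latentNoise_latentTranspose,
    LinearIsometryEquiv.norm_map, Matrix.transpose_add, Matrix.transpose_mul,
    Matrix.transpose_smul, Matrix.transpose_transpose, sqrt_transpose, Matrix.mul_assoc]

end Transposition

theorem mainTheorem2 {p₀ q₀ : ℕ} (hp₀ : 0 < p₀) (hq₀ : 0 < q₀)
    (T p q : ℕ → ℕ) (hT : Tendsto T atTop atTop) (hp : Tendsto p atTop atTop)
    (hq : Tendsto q atTop atTop)
    {Ω : ℕ → Type*} [∀ n, MeasurableSpace (Ω n)] (μ : ∀ n, Measure (Ω n))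
    [∀ n, IsProbabilityMeasure (μ n)]
    (R : ∀ n, Matrix (Fin (p n)) (Fin p₀) ℝ) (C : ∀ n, Matrix (Fin (q n)) (Fin q₀) ℝ)
    (Sig₁ : ℕ → Matrix (Fin p₀) (Fin p₀) ℝ) (Sig₂ : ℕ → Matrix (Fin q₀) (Fin q₀) ℝ)
    (Om₁ : ∀ n, Matrix (Fin (p n)) (Fin (p n)) ℝ) (Om₂ : ∀ n, Matrix (Fin (q n)) (Fin (q n)) ℝ)
    (ρ : ∀ n, Fin (T n) → Ω n → ℝ)
    (Z : ∀ n, Fin (T n) → Ω n → LatentSpace p₀ q₀ (p n) (q n))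
    (X : ∀ n, Fin (T n) → Ω n → Matrix (Fin (p n)) (Fin (q n)) ℝ)
    (hX : ∀ n t ω, X n t ω =
      observation (R n) (C n) (Sig₁ n) (Sig₂ n) (Om₁ n) (Om₂ n) (ρ n t ω) (Z n t ω))
    (hA : JointElliptical μ p₀ q₀ T p q ρ Z)
    (hB : StrongFactors R C Sig₁ Sig₂)
    (hC : RegularNoise Om₁ Om₂) :
    (∀ (Chat : ∀ n, Ω n → Matrix (Fin (q n)) (Fin q₀) ℝ)
        (Rnew : ∀ n, Ω n → Matrix (Fin (p n)) (Fin p₀) ℝ),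
      IsGivenEstimate μ (fun n ω t => (ρ n t ω, Z n t ω)) C Chat →
      (∀ n ω, IsMPCAFUpdate (min p₀ q₀) (fun t => X n t ω) (Chat n ω) (Rnew n ω)) →
      ∃ H : ∀ n, Ω n → Matrix (Fin p₀) (Fin p₀) ℝ,
        (∀ n ω, H n ω ∈ Matrix.orthogonalGroup (Fin p₀) ℝ) ∧
        IsBigOp μ (fun n ω => frobSq (Rnew n ω - R n * H n ω) / (p n : ℝ))
          (fun n => (T n : ℝ)⁻¹ + (q n : ℝ) ^ (-1 / 2 : ℝ))) ∧
    (∀ (Rhat : ∀ n, Ω n → Matrix (Fin (p n)) (Fin p₀) ℝ)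
        (Cnew : ∀ n, Ω n → Matrix (Fin (q n)) (Fin q₀) ℝ),
      IsGivenEstimate μ (fun n ω t => (ρ n t ω, Z n t ω)) R Rhat →
      (∀ n ω, IsMPCAFUpdate (min p₀ q₀) (fun t => (X n t ω).transpose) (Rhat n ω) (Cnew n ω)) →
      ∃ H : ∀ n, Ω n → Matrix (Fin q₀) (Fin q₀) ℝ,
        (∀ n ω, H n ω ∈ Matrix.orthogonalGroup (Fin q₀) ℝ) ∧
        IsBigOp μ (fun n ω => frobSq (Cnew n ω - C n * H n ω) / (q n : ℝ))
          (fun n => (T n : ℝ)⁻¹ + (p n : ℝ) ^ (-1 / 2 : ℝ))) := by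
  obtain ⟨c₁, C₁, hc₁, hC₁, hSig⟩ := hB.factor_cov
  obtain ⟨c₂, C₂, hc₂, hC₂, hOm⟩ := hC
  have hind : ∀ n, Pairwise fun s t => IndepFun (Z n s) (Z n t) (μ n) := fun n s t hst =>
    ((hA.indep_time n).indepFun hst).comp measurable_snd measurable_snd
  have hsel : ∀ n t, Measurable fun s : Fin (T n) → ℝ × LatentSpace p₀ q₀ (p n) (q n) => (s t).2 :=
    fun n t => measurable_snd.comp (measurable_pi_apply t)
  refine ⟨fun Chat Rnew hC hupd => ?_, fun Rhat Cnew hR hupd => ?_⟩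
  · obtain ⟨c, hc, hCc⟩ := hC.nondegenerate
    refine exists_rotation_isBigOp hp₀ hq₀ hT hp hq hA.radius_pos hA.measurable_latent
      hA.latent_law hind hB.row_normalized hc₁ hC₁ hc₂ hC₂ hSig hOm hC.measurable hC.normalized
      (fun n t => (hC.indep n).comp measurable_id (hsel n t)) hc hCc
      fun n ω => ?_
    simpa only [hX] using hupd n ω
  · obtain ⟨c, hc, hRc⟩ := hR.nondegenerate
    have hm : ∀ n, Measurable (latentTranspose p₀ q₀ (p n) (q n)) := fun n =>
      (latentTranspose p₀ q₀ (p n) (q n)).continuous.measurable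
    -- The transposed latent vectors are again standard Gaussian, and independence survives the
    -- measurable map.
    refine exists_rotation_isBigOp (Z := fun n t ω => latentTranspose p₀ q₀ (p n) (q n) (Z n t ω))
      hq₀ hp₀ hT hq hp hA.radius_pos (fun n t => (hm n).comp (hA.measurable_latent n t))
      (fun n t => ?_) (fun n s t hst => (hind n hst).comp (hm n) (hm n)) hB.col_normalized
      hc₁ hC₁ hc₂ hC₂ (fun n => (hSig n).symm) (fun n => (hOm n).symm) hR.measurable hR.normalized
      (fun n t => (hR.indep n).comp measurable_id ((hm n).comp (hsel n t)))
      hc hRc fun n ω => ?_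
    · rw [← stdGaussian_map (latentTranspose p₀ q₀ (p n) (q n)), ← hA.latent_law n t,
        Measure.map_map (hm n) (hA.measurable_latent n t)]
      rfl
    · have h := hupd n ω
      simp only [hX, observation_transpose] at h
      rwa [min_comm] at h
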